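/- Let $n,m,T\in\mathbb{R}$. For $k\in\{1,2\}$, call $\phi=\phi(z,t)$, $z\in\mathbb{R}$, $0\le t<T$, an $H^k$ solution on $[0,T)$ of $$\bigl(\phi^m-\partial_z\phi^n\partial_z\bigr)[\phi^{-m}\phi_t]=-(\phi^n)_z$$ if $\phi>0$, $\phi-1\in C^1([0,T);H^k(\mathbb{R}))$ (with $\phi(\cdot,t)$ its continuous representative), and for every $t$ there is $u(\cdot,t)\in H^1(\mathbb{R})$ with $\phi_t=\phi^m u$ and $-(\phi^n u_z)_z+\phi^m u=-(\phi^n)_z$ in the weak sense. Put $$\mathcal{E}[\phi]=\int_{\mathbb{R}}\tfrac12\phi^{-2m}\phi_z^2+V_{n,m}(\phi)\,dz,\qquad V_{n,m}(x)=\begin{cases}x\log x-x+1,& n+m=1,\\ -\log x+x-1,& n+m=2,\\ \dfrac{x^{2-n-m}-1+(n+m-2)(x-1)}{(n+m-1)(n+m-2)},&\text{otherwise.}\end{cases}$$ (1) Let $\phi$ be an $H^2$ solution on $[0,T)$, and let $$e=\tfrac12\phi^{-2m}\phi_z^2+V_{n,m}(\phi),\qquad f=W(\phi)\bigl(\phi^n+m\phi^{n-m-1}\phi_t\phi_z-\phi^{n-m}\phi_{tz}\bigr)-P(\phi),$$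 where $W(x)=\frac{1-x^{1-n-m}}{n+m-1}$ if $n+m\ne1$ and $W(x)=\log x$ if $n+m=1$, and $P(x)=\frac{x^{1-m}}{1-m}$ if $m\neq1$ and $P(x)=\log x$ if $m=1$. (For $n+m\ne1$, $m\neq 1$ this is $f=\frac1{n+m-1}\bigl(\phi^n+m\phi^{n-m-1}\phi_t\phi_z-\phi^{n-m}\phi_{tz}-\frac{n}{1-m}\phi^{1-m}-m\phi^{-2m}\phi_z\phi_t+\phi^{1-2m}\phi_{zt}\bigr)$.) Then the classical derivatives $\phi_z,\phi_t,\phi_{tz},\partial_te,\partial_zf$ exist and $$\partial_te+\partial_zf=0\quad\text{for all }z\in\mathbb{R},\ 0\le t<T$$ (time derivatives being one-sided at $t=0$). Moreover, for all $t\in[0,T)$, $e(\cdot,t)$ is integrable, $\int e(z,t)\,dz=\mathcal{E}[\phi(\cdot,t)]$ and $\mathcal{E}[\phi(\cdot,t)]=\mathcal{E}[\phi(\cdot,0)]$. (2) Let $\phi$ be an $H^1$ solution on $[0,T)$. Then for all $t\in[0,T)$ the integrand of $\mathcal{E}[\phi(\cdot,t)]$ (with $\phi_z$ the weak derivative) is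 integrable and $\mathcal{E}[\phi(\cdot,t)]=\mathcal{E}[\phi(\cdot,0)]$. This holds for initial data of any size and all $n,m$; in particular for data with $\|\phi(\cdot,0)-1\|_{H^1}$ small and arbitrary $n,m$, and for data of arbitrary size when $n+m\ge3$, $n+3m\ge4$, $n+3m<6$. -/

import Mathlib

open MeasureTheory Set
open scoped ContDiff

noncomputable section

namespace Magma

/-- Real-valued square integrable functions on the line. -/
abbrev L2 := Lp ℝ 2 (volume : Measure ℝ)

/-- `h` is a weak derivative of `g` on the real line. -/
def IsWeakDeriv (g h : ℝ → ℝ) : Prop :=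
  LocallyIntegrable g ∧ LocallyIntegrable h ∧
    ∀ ψ : ℝ → ℝ, ContDiff ℝ ∞ ψ → HasCompactSupport ψ →
      ∫ z, g z * deriv ψ z = - ∫ z, h z * ψ z

theorem IsWeakDeriv.congr {g g' h h' : ℝ → ℝ} (H : IsWeakDeriv g h)
    (hg : g =ᵐ[volume] g') (hh : h =ᵐ[volume] h') : IsWeakDeriv g' h' := by
  obtain ⟨h1, h2, h3⟩ := H
  refine ⟨h1.congr hg, h2.congr hh, fun ψ hψ hc => ?_⟩
  have e1 : ∫ z, g' z * deriv ψ z = ∫ z, g z * deriv ψ z :=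
    integral_congr_ae (by filter_upwards [hg] with z hz; rw [hz])
  have e2 : ∫ z, h' z * ψ z = ∫ z, h z * ψ z :=
    integral_congr_ae (by filter_upwards [hh] with z hz; rw [hz])
  rw [e1, e2, h3 ψ hψ hc]

theorem integrable_mul_test {g ψ : ℝ → ℝ} (hg : LocallyIntegrable g) (hψ : Continuous ψ)
    (hc : HasCompactSupport ψ) : Integrable (fun z => g z * ψ z) := by
  have := hg.integrable_smul_right_of_hasCompactSupport hψ hc
  simpa [smul_eq_mul] using this

theorem IsWeakDeriv.add {g g' h h' : ℝ → ℝ} (H : IsWeakDeriv g h) (H' : IsWeakDeriv g' h') :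
    IsWeakDeriv (g + g') (h + h') := by
  refine ⟨H.1.add H'.1, H.2.1.add H'.2.1, fun ψ hψ hc => ?_⟩
  have hd : Continuous (deriv ψ) := hψ.continuous_deriv (by simp)
  simp only [Pi.add_apply, add_mul]
  rw [integral_add (integrable_mul_test H.1 hd hc.deriv) (integrable_mul_test H'.1 hd hc.deriv),
    integral_add (integrable_mul_test H.2.1 hψ.continuous hc)
      (integrable_mul_test H'.2.1 hψ.continuous hc), H.2.2 ψ hψ hc, H'.2.2 ψ hψ hc]
  ring

theorem IsWeakDeriv.const_smul {g h : ℝ → ℝ} (c : ℝ) (H : IsWeakDeriv g h) :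
    IsWeakDeriv (c • g) (c • h) := by
  refine ⟨H.1.smul c, H.2.1.smul c, fun ψ hψ hc => ?_⟩
  simp only [Pi.smul_apply, smul_eq_mul, mul_assoc, integral_const_mul]
  rw [H.2.2 ψ hψ hc]
  ring

theorem isWeakDeriv_zero : IsWeakDeriv 0 0 :=
  ⟨locallyIntegrable_zero, locallyIntegrable_zero, fun ψ _ _ => by simp⟩

/-- The Sobolev space `H^k(ℝ) = W^{k,2}(ℝ)`. An element is the tuple `(v, v', …, v^(k))` of a
function and its weak derivatives, all in `L²`; its norm is
`(‖v‖₂² + ‖v'‖₂² + … + ‖v^(k)‖₂²)^(1/2)`. -/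
def Sobolev (k : ℕ) : Submodule ℝ (PiLp 2 fun _ : Fin (k + 1) => L2) where
  carrier := {v | ∀ j : Fin k, IsWeakDeriv (v j.castSucc) (v j.succ)}
  zero_mem' := fun _ =>
    isWeakDeriv_zero.congr (Lp.coeFn_zero ℝ 2 volume).symm (Lp.coeFn_zero ℝ 2 volume).symm
  add_mem' := fun ha hb j =>
    ((ha j).add (hb j)).congr (Lp.coeFn_add _ _).symm (Lp.coeFn_add _ _).symm
  smul_mem' := fun c _ ha j =>
    ((ha j).const_smul c).congr (Lp.coeFn_smul c _).symm (Lp.coeFn_smul c _).symm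

open Classical in
/-- The weak derivative of a function on the line (unique up to null sets). -/
def weakDeriv (g : ℝ → ℝ) : ℝ → ℝ :=
  if h : ∃ g', IsWeakDeriv g g' then h.choose else 0

/-- `φ` (as `φ t z`) is a solution of the magma equation
`(φ^m - ∂_z φ^n ∂_z)[φ^{-m} φ_t] = -(φ^n)_z` on `[0, T)` with `φ > 0` and
`φ - 1 ∈ C¹([0, T); H^k(ℝ))`, `φ t` being the continuous representative: there is `u t ∈ H¹` with
`φ_t = φ^m u` (time derivative in `H^k`) and `-(φ^n u_z)_z + φ^m u = -(φ^n)_z` weakly. -/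
structure IsSolution (n m : ℝ) (k : ℕ) (T : ℝ) (φ : ℝ → ℝ → ℝ) : Prop where
  continuous : ∀ t ∈ Ico 0 T, Continuous (φ t)
  pos : ∀ t ∈ Ico 0 T, ∀ z, 0 < φ t z
  equation : ∃ U : ℝ → Sobolev k,
    ContDiffOn ℝ 1 U (Ico 0 T) ∧
    (∀ t ∈ Ico 0 T, (fun z => φ t z - 1) =ᵐ[volume] (U t).1 0) ∧
    ∀ t ∈ Ico 0 T, ∃ u : Sobolev 1,
      ((derivWithin U (Ico 0 T) t).1 0 =ᵐ[volume] fun z => φ t z ^ m * u.1 0 z) ∧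
      ∀ ψ : ℝ → ℝ, ContDiff ℝ ∞ ψ → HasCompactSupport ψ →
        ∫ z, (φ t z ^ n * u.1 1 z * deriv ψ z + φ t z ^ m * u.1 0 z * ψ z)
          = ∫ z, φ t z ^ n * deriv ψ z

/-- The potential `V_{n,m}`. -/
def potential (n m x : ℝ) : ℝ :=
  if n + m = 1 then x * Real.log x - x + 1
  else if n + m = 2 then -Real.log x + x - 1
  else (x ^ (2 - n - m) - 1 + (n + m - 2) * (x - 1)) / ((n + m - 1) * (n + m - 2))

/-- The energy density `½ φ^{-2m} φ_z² + V_{n,m}(φ)` at `φ = a`, `φ_z = b`. -/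
def energyDensity (n m a b : ℝ) : ℝ :=
  1 / 2 * a ^ (-2 * m) * b ^ 2 + potential n m a

/-- The energy functional `𝓔[w] = ∫ ½ w^{-2m} w_z² + V_{n,m}(w) dz`. -/
def energy (n m : ℝ) (w : ℝ → ℝ) : ℝ :=
  ∫ z, energyDensity n m (w z) (weakDeriv w z)

/-- The multiplier `(1 - x^{1-n-m}) / (n+m-1)`, and `log x` when `n + m = 1`. -/
def multiplier (n m x : ℝ) : ℝ :=
  if n + m = 1 then Real.log x else (1 - x ^ (1 - n - m)) / (n + m - 1)

/-- The flux `J = φ^n + m φ^{n-m-1} φ_t φ_z - φ^{n-m} φ_{tz}` of the equation `φ_t + J_z = 0`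
at `φ = a`, `φ_z = b`, `φ_t = c`, `φ_{tz} = d`. -/
def massFlux (n m a b c d : ℝ) : ℝ :=
  a ^ n + m * a ^ (n - m - 1) * c * b - a ^ (n - m) * d

/-- The energy flux `f` at `φ = a`, `φ_z = b`, `φ_t = c`, `φ_{tz} = d`. -/
def energyFlux (n m a b c d : ℝ) : ℝ :=
  multiplier n m a * massFlux n m a b c d
    - (if m = 1 then Real.log a else a ^ (1 - m) / (1 - m))

/-- The energy flux written out in the generic case. -/
theorem energyFlux_eq {n m a : ℝ} (h1 : n + m ≠ 1) (hm : m ≠ 1) (ha : 0 < a) (b c d : ℝ) :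
    energyFlux n m a b c d = 1 / (n + m - 1) *
      (a ^ n + m * a ^ (n - m - 1) * c * b - a ^ (n - m) * d - n / (1 - m) * a ^ (1 - m)
        - m * a ^ (-2 * m) * b * c + a ^ (1 - 2 * m) * d) := by
  have e1 : a ^ (1 - n - m) * a ^ n = a ^ (1 - m) := by
    rw [← Real.rpow_add ha]; congr 1; ring
  have e2 : a ^ (1 - n - m) * a ^ (n - m - 1) = a ^ (-2 * m) := by
    rw [← Real.rpow_add ha]; congr 1; ring
  have e3 : a ^ (1 - n - m) * a ^ (n - m) = a ^ (1 - 2 * m) := by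
    rw [← Real.rpow_add ha]; congr 1; ring
  have h1' : n + m - 1 ≠ 0 := sub_ne_zero.2 h1
  have hm' : 1 - m ≠ 0 := sub_ne_zero.2 (Ne.symm hm)
  rw [energyFlux, multiplier, massFlux, if_neg h1, if_neg hm, ← e1, ← e2, ← e3]
  field_simp
  ring

/-- `φ_t(z, t)`; at `t = 0` the one-sided derivative. -/
def timeDeriv (T : ℝ) (φ : ℝ → ℝ → ℝ) (t z : ℝ) : ℝ :=
  derivWithin (fun s => φ s z) (Ico 0 T) t

/-- The energy density `e(z, t)` of `φ`, for `φ t` differentiable in space. -/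
def e (n m : ℝ) (φ : ℝ → ℝ → ℝ) (t z : ℝ) : ℝ :=
  energyDensity n m (φ t z) (deriv (φ t) z)

/-- The energy flux `f(z, t)` of `φ`. -/
def f (n m T : ℝ) (φ : ℝ → ℝ → ℝ) (t z : ℝ) : ℝ :=
  energyFlux n m (φ t z) (deriv (φ t) z) (timeDeriv T φ t z) (deriv (timeDeriv T φ t) z)

end Magma

end

/-! With u = φ^{-m} φ_t the equation is the conservation law φ_t + J_z = 0, where J = φ^n - φ^n u_z.
Multiply it by W(φ), where W = V' and W' = x^{-n-m}. Then V(φ)_t + (W(φ) J)_z = φ^{-n-m} φ_z J =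
φ^{-m} φ_z - φ^{-m} φ_z u_z. The first term is P(φ)_z. In the second, φ^{-m} φ_z and u are the z-
and t-derivatives of P(φ), so u_z = (φ^{-m} φ_z)_t and the term is minus the t-derivative of ½
φ^{-2m} φ_z². Hence e_t + (W J - P)_z = 0.

In H² all these derivatives are classical: elements of H¹ have continuous representatives, and
evaluation at a point is bounded on H¹, so it commutes with the time derivative
(`local_conservation`).

In H¹ there is no pointwise law, but neither is an approximation needed. The energy is Fréchet
differentiable on H¹ at every positive profile 1 + v (`hasFDerivAt_energyFunctional`). Its
derivative in the direction φ_t is the integral of -(W J - P)_z, where J has a locally absolutely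
continuous representative; W J - P has the limit -P(1) at both ends, so the integral vanishes
(`energyDeriv_eq_zero`). The chain rule in time then gives conservation, which H² solutions inherit
through H² ⊂ H¹. -/

noncomputable section

namespace Magma

open Filter
open scoped Topology NNReal Interval

/-! ### Calculus of locally absolutely continuous functions -/

/-- `g` is locally absolutely continuous on the line, with derivative `h` almost everywhere. -/
structure IsPrimitive (g h : ℝ → ℝ) : Prop where
  ac : ∀ a b, AbsolutelyContinuousOnInterval g a b
  ae_hasDerivAt : ∀ᵐ x, HasDerivAt g (h x) x

namespace IsPrimitive

variable {g h g₁ h₁ g₂ h₂ : ℝ → ℝ}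

theorem continuous (H : IsPrimitive g h) : Continuous g := by
  rw [continuous_iff_continuousAt]
  intro x
  have := (H.ac (x - 1) (x + 1)).continuousOn
  rw [uIcc_of_le (by linarith)] at this
  exact this.continuousAt (Icc_mem_nhds (by linarith) (by linarith))

theorem deriv_ae_eq (H : IsPrimitive g h) : deriv g =ᵐ[volume] h := by
  filter_upwards [H.ae_hasDerivAt] with x hx using hx.deriv

theorem intervalIntegrable (H : IsPrimitive g h) (a b : ℝ) : IntervalIntegrable h volume a b :=
  (H.ac a b).intervalIntegrable_deriv.congr_ae (ae_restrict_of_ae H.deriv_ae_eq)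

theorem locallyIntegrable (H : IsPrimitive g h) : LocallyIntegrable h := by
  intro x
  refine ⟨Icc (x - 1) (x + 1), Icc_mem_nhds (by linarith) (by linarith), ?_⟩
  have := H.intervalIntegrable (x - 1) (x + 1)
  rwa [intervalIntegrable_iff_integrableOn_Icc_of_le (by linarith)] at this

theorem integral_eq_sub (H : IsPrimitive g h) (a b : ℝ) : ∫ x in a..b, h x = g b - g a := by
  rw [← (H.ac a b).integral_deriv_eq_sub]
  refine intervalIntegral.integral_congr_ae ?_
  filter_upwards [H.deriv_ae_eq] with x hx _ using hx.symm

theorem congr_deriv (H : IsPrimitive g h) (hh : h =ᵐ[volume] h₁) : IsPrimitive g h₁ :=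
  ⟨H.ac, by filter_upwards [H.ae_hasDerivAt, hh] with x hx e using e ▸ hx⟩

theorem deriv_unique (H : IsPrimitive g h) (H₁ : IsPrimitive g h₁) : h =ᵐ[volume] h₁ :=
  H.deriv_ae_eq.symm.trans H₁.deriv_ae_eq

theorem of_locallyIntegrable (hh : LocallyIntegrable h) (a : ℝ) :
    IsPrimitive (fun x => ∫ t in a..x, h t) h := by
  have hi : ∀ x y, IntervalIntegrable h volume x y := fun x y =>
    (hh.integrableOn_isCompact isCompact_uIcc).intervalIntegrable
  refine ⟨fun x y => ?_, ?_⟩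
  · have := (hi (min a (min x y)) (max a (max x y))).absolutelyContinuousOnInterval_intervalIntegral
      (c := a) (by rw [uIcc_of_le (by simp)]; simp)
    refine this.mono ?_
    rw [uIcc_of_le (a := min a (min x y)) (by simp)]
    exact Icc_subset_Icc (min_le_right _ _) (le_max_right _ _)
  · filter_upwards [_root_.LocallyIntegrable.ae_hasDerivAt_integral hh] with x hx using hx a

theorem of_hasDerivAt (hg : ∀ x, HasDerivAt g (h x) x) (hh : Continuous h) : IsPrimitive g h := by
  refine ⟨fun a b => ContDiffOn.absolutelyContinuousOnInterval (ContDiff.contDiffOn ?_),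
    ae_of_all _ hg⟩
  rw [contDiff_one_iff_deriv]
  refine ⟨fun x => (hg x).differentiableAt, ?_⟩
  rwa [show deriv g = h from funext fun x => (hg x).deriv]

theorem const (c : ℝ) : IsPrimitive (fun _ => c) (fun _ => 0) :=
  of_hasDerivAt (fun _ => hasDerivAt_const _ _) continuous_const

theorem add (H₁ : IsPrimitive g₁ h₁) (H₂ : IsPrimitive g₂ h₂) :
    IsPrimitive (fun x => g₁ x + g₂ x) (fun x => h₁ x + h₂ x) :=
  ⟨fun a b => (H₁.ac a b).add (H₂.ac a b), by
    filter_upwards [H₁.ae_hasDerivAt, H₂.ae_hasDerivAt] with x a b using a.add b⟩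

theorem sub (H₁ : IsPrimitive g₁ h₁) (H₂ : IsPrimitive g₂ h₂) :
    IsPrimitive (fun x => g₁ x - g₂ x) (fun x => h₁ x - h₂ x) :=
  ⟨fun a b => (H₁.ac a b).sub (H₂.ac a b), by
    filter_upwards [H₁.ae_hasDerivAt, H₂.ae_hasDerivAt] with x a b using a.sub b⟩

theorem mul (H₁ : IsPrimitive g₁ h₁) (H₂ : IsPrimitive g₂ h₂) :
    IsPrimitive (fun x => g₁ x * g₂ x) (fun x => h₁ x * g₂ x + g₁ x * h₂ x) :=
  ⟨fun a b => (H₁.ac a b).mul (H₂.ac a b), by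
    filter_upwards [H₁.ae_hasDerivAt, H₂.ae_hasDerivAt] with x a b using a.mul b⟩

end IsPrimitive

theorem _root_.LipschitzOnWith.comp_absolutelyContinuousOnInterval {F g : ℝ → ℝ} {K : ℝ≥0}
    {s : Set ℝ} {a b : ℝ} (hF : LipschitzOnWith K F s) (hg : AbsolutelyContinuousOnInterval g a b)
    (hs : MapsTo g (uIcc a b) s) : AbsolutelyContinuousOnInterval (F ∘ g) a b := by
  rw [absolutelyContinuousOnInterval_iff] at hg ⊢
  intro ε hε
  -- Dividing by `K + 1` rather than `K` covers `K = 0`.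
  obtain ⟨δ, hδ, H⟩ := hg (ε / (K + 1)) (by positivity)
  refine ⟨δ, hδ, fun E hE hlt => ?_⟩
  calc ∑ i ∈ Finset.range E.1, dist ((F ∘ g) (E.2 i).1) ((F ∘ g) (E.2 i).2)
      ≤ ∑ i ∈ Finset.range E.1, (K + 1) * dist (g (E.2 i).1) (g (E.2 i).2) := by
        refine Finset.sum_le_sum fun i hi => ?_
        have := hF.dist_le_mul _ (hs (hE.1 i hi).1) _ (hs (hE.1 i hi).2)
        have h0 : 0 ≤ dist (g (E.2 i).1) (g (E.2 i).2) := dist_nonneg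
        simp only [Function.comp]
        linarith
    _ = (K + 1) * ∑ i ∈ Finset.range E.1, dist (g (E.2 i).1) (g (E.2 i).2) := by
        rw [Finset.mul_sum]
    _ < (K + 1) * (ε / (K + 1)) := by
        gcongr
        exact H E hE hlt
    _ = ε := by field_simp

/-- On a compact interval `g` takes values between its minimum and maximum, a compact part of (0, ∞)
on which the C¹ function `F` is Lipschitz; Lipschitz functions preserve absolute continuity. -/
theorem IsPrimitive.comp {g h F F' : ℝ → ℝ} (H : IsPrimitive g h) (hpos : ∀ x, 0 < g x)
    (hF : ∀ y, 0 < y → HasDerivAt F (F' y) y) (hF' : ContinuousOn F' (Ioi 0)) :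
    IsPrimitive (fun x => F (g x)) (fun x => F' (g x) * h x) := by
  have hC : ContDiffOn ℝ 1 F (Ioi 0) := by
    rw [show (1 : WithTop ℕ∞) = 0 + 1 from rfl, contDiffOn_succ_iff_deriv_of_isOpen isOpen_Ioi]
    refine ⟨fun y hy => (hF y hy).differentiableAt.differentiableWithinAt, by simp, ?_⟩
    rw [contDiffOn_zero]
    exact hF'.congr fun y hy => (hF y hy).deriv
  refine ⟨fun a b => ?_, ?_⟩
  · obtain ⟨p, hp, hpm⟩ := isCompact_uIcc.exists_isMinOn (nonempty_uIcc (a := a) (b := b))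
      H.continuous.continuousOn
    obtain ⟨q, hq, hqm⟩ := isCompact_uIcc.exists_isMaxOn (nonempty_uIcc (a := a) (b := b))
      H.continuous.continuousOn
    obtain ⟨K, hK⟩ := (hC.mono (fun y (hy : y ∈ Icc (g p) (g q)) =>
      (hpos p).trans_le hy.1)).exists_lipschitzOnWith (by decide) (convex_Icc _ _) isCompact_Icc
    exact hK.comp_absolutelyContinuousOnInterval (H.ac a b) fun x hx => ⟨hpm hx, hqm hx⟩
  · filter_upwards [H.ae_hasDerivAt] with x hx
    exact (hF _ (hpos x)).comp x hx

/-! ### Weak derivatives and absolute continuity -/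

theorem exists_forall_le_abs_eq_zero {ψ : ℝ → ℝ} (hc : HasCompactSupport ψ) :
    ∃ R : ℝ, 0 < R ∧ ∀ x, R ≤ |x| → ψ x = 0 := by
  obtain ⟨R, hR, h⟩ := hc.isBounded.subset_closedBall_lt 0 0
  refine ⟨R + 1, by linarith, fun x hx => ?_⟩
  by_contra hne
  have := h (subset_tsupport _ hne)
  simp at this
  linarith

theorem integral_eq_intervalIntegral_of_abs {ψ : ℝ → ℝ} {R S : ℝ}
    (h : ∀ x, R ≤ |x| → ψ x = 0) (hS : R ≤ S) : ∫ x, ψ x = ∫ x in (-R)..S, ψ x := by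
  refine (intervalIntegral.integral_eq_integral_of_support_subset fun x hx => ?_).symm
  have h1 : |x| < R := by
    by_contra hh
    exact hx (h x (not_lt.1 hh))
  exact ⟨(abs_lt.1 h1).1, (abs_lt.1 h1).2.le.trans hS⟩

theorem IsPrimitive.isWeakDeriv {g h : ℝ → ℝ} (H : IsPrimitive g h) : IsWeakDeriv g h := by
  refine ⟨H.continuous.locallyIntegrable, H.locallyIntegrable, fun ψ hψ hc => ?_⟩
  have hd : Continuous (deriv ψ) := hψ.continuous_deriv (by simp)
  have Hψ : IsPrimitive ψ (deriv ψ) :=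
    .of_hasDerivAt (fun x => (hψ.differentiable (by simp) x).hasDerivAt) hd
  obtain ⟨R, hR, h0⟩ := exists_forall_le_abs_eq_zero hc
  obtain ⟨R', hR', h0'⟩ := exists_forall_le_abs_eq_zero hc.deriv
  have i1 := integrable_mul_test H.continuous.locallyIntegrable hd hc.deriv
  have i2 := integrable_mul_test H.locallyIntegrable hψ.continuous hc
  have key : ∫ z, (h z * ψ z + g z * deriv ψ z) = 0 := by
    rw [integral_eq_intervalIntegral_of_abs (R := max R R') (S := max R R') _ le_rfl,
      (H.mul Hψ).integral_eq_sub, h0, h0]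
    · simp
    · rw [abs_neg]; exact (le_max_left _ _).trans (le_abs_self _)
    · exact (le_max_left _ _).trans (le_abs_self _)
    · intro x hx
      rw [h0 x ((le_max_left _ _).trans hx), h0' x ((le_max_right _ _).trans hx)]
      simp
  rw [integral_add i2 i1] at key
  linarith

/-- The du Bois-Reymond argument. Fix a bump `r` of mass one. For a test function χ, the function χ
- (∫ χ) r has mean zero, so its primitive ψ is again a test function. Testing with ψ shows that g -
∫ g r is orthogonal to every χ. -/
theorem IsWeakDeriv.ae_const {g : ℝ → ℝ} (H : IsWeakDeriv g 0) :
    ∃ c, g =ᵐ[volume] fun _ => c := by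
  let ρ : ContDiffBump (0 : ℝ) := ⟨1, 2, one_pos, one_lt_two⟩
  let r : ℝ → ℝ := ρ.normed volume
  have hr : ContDiff ℝ ∞ r := ρ.contDiff_normed
  have hrc : HasCompactSupport r := ρ.hasCompactSupport_normed
  have hr1 : ∫ x, r x = 1 := ρ.integral_normed
  refine ⟨∫ x, g x * r x, ?_⟩
  suffices h : ∀ᵐ x, g x - (∫ x, g x * r x) = 0 by
    filter_upwards [h] with x hx using sub_eq_zero.1 hx
  refine ae_eq_zero_of_integral_contDiff_smul_eq_zero
    (H.1.sub (locallyIntegrable_const _)) fun χ hχ hχc => ?_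
  set I := ∫ x, χ x with hI
  let η : ℝ → ℝ := fun x => χ x - I * r x
  have hη : ContDiff ℝ ∞ η := hχ.sub (contDiff_const.mul hr)
  have hηc : HasCompactSupport η := hχc.sub (hrc.mul_left (f := fun _ => I))
  have iχ : Integrable χ := hχ.continuous.integrable_of_hasCompactSupport hχc
  have ir : Integrable r := hr.continuous.integrable_of_hasCompactSupport hrc
  have hη0 : ∫ x, η x = 0 := by
    simp only [η]
    rw [integral_sub iχ (ir.const_mul I), integral_const_mul, hr1, ← hI]
    ring
  obtain ⟨R, hR, h0⟩ := exists_forall_le_abs_eq_zero hηc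
  let ψ : ℝ → ℝ := fun x => ∫ t in (-R)..x, η t
  have hψd : ∀ x, HasDerivAt ψ (η x) x := fun x =>
    intervalIntegral.integral_hasDerivAt_right (hη.continuous.intervalIntegrable _ _)
      (hη.continuous.stronglyMeasurableAtFilter _ _) hη.continuous.continuousAt
  have hde : deriv ψ = η := funext fun x => (hψd x).deriv
  have hψ : ContDiff ℝ ∞ ψ := by
    rw [contDiff_infty_iff_deriv, hde]
    exact ⟨fun x => (hψd x).differentiableAt, hη⟩
  have hψc : HasCompactSupport ψ := by
    refine HasCompactSupport.intro (isCompact_Icc (a := -R) (b := R)) fun x hx => ?_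
    rcases lt_or_ge x (-R) with h | h
    · simp only [ψ]
      rw [intervalIntegral.integral_congr (g := fun _ => 0), intervalIntegral.integral_zero]
      intro t ht
      rw [uIcc_of_ge h.le] at ht
      exact h0 t (by rw [abs_of_nonpos (by linarith [ht.2])]; linarith [ht.2])
    · have h' : R ≤ x := by
        by_contra hh
        exact hx ⟨h, (not_le.1 hh).le⟩
      simp only [ψ]
      rw [← integral_eq_intervalIntegral_of_abs h0 h', hη0]
  have := H.2.2 ψ hψ hψc
  rw [hde] at this
  simp only [η, Pi.zero_apply, zero_mul, integral_zero, neg_zero, mul_sub] at this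
  have j1 := integrable_mul_test H.1 hχ.continuous hχc
  have j2 := integrable_mul_test H.1 hr.continuous hrc
  have e2 : (fun z => g z * (I * r z)) = fun z => I * (g z * r z) := by
    ext z; ring
  rw [integral_sub j1 (by rw [e2]; exact j2.const_mul I), e2, integral_const_mul] at this
  have e3 : (fun x => χ x • (g x - ∫ x, g x * r x))
      = fun x => g x * χ x - (∫ x, g x * r x) * χ x := by
    ext z; simp only [smul_eq_mul]; ring
  rw [e3,
    integral_sub j1 (iχ.const_mul _), integral_const_mul, ← hI]
  linarith

theorem IsWeakDeriv.exists_isPrimitive {g h : ℝ → ℝ} (H : IsWeakDeriv g h) :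
    ∃ g', g =ᵐ[volume] g' ∧ IsPrimitive g' h := by
  have P := IsPrimitive.of_locallyIntegrable H.2.1 0
  have H0 : IsWeakDeriv (g - fun x => ∫ t in (0 : ℝ)..x, h t) 0 := by
    have := H.add (P.isWeakDeriv.const_smul (-1))
    refine this.congr (ae_of_all _ fun x => ?_) (ae_of_all _ fun x => ?_)
    · simp; ring
    · simp
  obtain ⟨c, hc⟩ := H0.ae_const
  refine ⟨fun x => (∫ t in (0 : ℝ)..x, h t) + c, ?_, by simpa using P.add (.const c)⟩
  filter_upwards [hc] with x hx
  simp only [Pi.sub_apply] at hx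
  linarith

theorem IsWeakDeriv.isPrimitive {g h : ℝ → ℝ} (H : IsWeakDeriv g h) (hg : Continuous g) :
    IsPrimitive g h := by
  obtain ⟨g', e, P⟩ := H.exists_isPrimitive
  rwa [(hg.ae_eq_iff_eq volume P.continuous).1 e]

theorem weakDeriv_ae_eq {g h : ℝ → ℝ} (H : IsPrimitive g h) : weakDeriv g =ᵐ[volume] h := by
  have hex : ∃ g', IsWeakDeriv g g' := ⟨h, H.isWeakDeriv⟩
  have : IsWeakDeriv g (weakDeriv g) := by
    rw [weakDeriv, dif_pos hex]
    exact hex.choose_spec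
  exact (this.isPrimitive H.continuous).deriv_unique H

/-! ### Sup bound and decay at infinity for H¹ functions -/

/-- For y in [z, z + 1], g(z)² - g(y)² = -∫ 2 g h over [z, y], at most ∫ (g² + h²); now average over
y. The local form yields both the sup bound and, since integrals over escaping unit intervals
vanish, the decay. -/
theorem IsPrimitive.sq_le {g h : ℝ → ℝ} (H : IsPrimitive g h) (hg : MemLp g 2) (hh : MemLp h 2)
    (z : ℝ) : g z ^ 2 ≤ ∫ x in z..z + 1, (2 * g x ^ 2 + h x ^ 2) := by
  have ig : ∀ a b, IntervalIntegrable (fun x => g x ^ 2) volume a b := fun a b =>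
    hg.integrable_sq.intervalIntegrable
  have ih : ∀ a b, IntervalIntegrable (fun x => h x ^ 2) volume a b := fun a b =>
    hh.integrable_sq.intervalIntegrable
  have igh : ∀ a b, IntervalIntegrable (fun x => g x ^ 2 + h x ^ 2) volume a b := fun a b =>
    (ig a b).add (ih a b)
  have key : ∀ y ∈ Icc z (z + 1),
      g z ^ 2 - (∫ x in z..z + 1, (g x ^ 2 + h x ^ 2)) ≤ g y ^ 2 := by
    intro y hy
    have e := (H.mul H).integral_eq_sub z y
    have b1 : -(∫ x in z..y, (h x * g x + g x * h x)) ≤ ∫ x in z..y, (g x ^ 2 + h x ^ 2) := by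
      rw [← intervalIntegral.integral_neg]
      refine intervalIntegral.integral_mono_on hy.1 ((H.mul H).intervalIntegrable z y).neg
        (igh z y) fun x _ => ?_
      nlinarith [sq_nonneg (g x + h x)]
    have b2 : ∫ x in z..y, (g x ^ 2 + h x ^ 2) ≤ ∫ x in z..z + 1, (g x ^ 2 + h x ^ 2) :=
      intervalIntegral.integral_mono_interval le_rfl hy.1 hy.2
        (ae_of_all _ fun x => by simp only [Pi.zero_apply]; positivity) (igh _ _)
    nlinarith
  have := intervalIntegral.integral_mono_on (by linarith : z ≤ z + 1)
    (intervalIntegrable_const (μ := volume)) (ig z (z + 1)) key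
  rw [intervalIntegral.integral_const, add_sub_cancel_left, one_smul] at this
  calc g z ^ 2 ≤ (∫ x in z..z + 1, g x ^ 2) + ∫ x in z..z + 1, (g x ^ 2 + h x ^ 2) := by linarith
    _ = ∫ x in z..z + 1, (g x ^ 2 + (g x ^ 2 + h x ^ 2)) :=
      (intervalIntegral.integral_add (ig _ _) (igh _ _)).symm
    _ = _ := by congr 1; ext x; ring

theorem IsPrimitive.sq_le_integral {g h : ℝ → ℝ} (H : IsPrimitive g h) (hg : MemLp g 2)
    (hh : MemLp h 2) (z : ℝ) : g z ^ 2 ≤ 2 * ((∫ x, g x ^ 2) + ∫ x, h x ^ 2) := by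
  refine (H.sq_le hg hh z).trans ?_
  have i1 := hg.integrable_sq.const_mul 2
  have i2 := hh.integrable_sq
  rw [intervalIntegral.integral_of_le (by linarith)]
  refine (setIntegral_le_integral (i1.add i2) (ae_of_all _ fun x => ?_)).trans ?_
  · simp only [Pi.zero_apply, Pi.add_apply]; positivity
  · simp only [Pi.add_apply]
    rw [integral_add i1 i2, integral_const_mul]
    have : 0 ≤ ∫ x, h x ^ 2 := integral_nonneg fun x => sq_nonneg _
    linarith

theorem tendsto_integral_add_one {F : ℝ → ℝ} (hF : Integrable F) {l : Filter ℝ}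
    (hl : l = atTop ∨ l = atBot) : Tendsto (fun z => ∫ x in z..z + 1, F x) l (𝓝 0) := by
  have hlim : ∃ L, Tendsto (fun z => ∫ x in (0 : ℝ)..z, F x) l (𝓝 L) := by
    rcases hl with rfl | rfl
    · exact ⟨_, intervalIntegral_tendsto_integral_Ioi 0 hF.integrableOn tendsto_id⟩
    · refine ⟨_, ((intervalIntegral_tendsto_integral_Iic 0 hF.integrableOn tendsto_id).neg).congr
        fun z => ?_⟩
      rw [intervalIntegral.integral_symm]; simp
  obtain ⟨L, hL⟩ := hlim
  have hs : Tendsto (fun z : ℝ => z + 1) l l := by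
    rcases hl with rfl | rfl
    · exact tendsto_atTop_add_const_right _ _ tendsto_id
    · exact tendsto_atBot_add_const_right _ _ tendsto_id
  have := (hL.comp hs).sub hL
  rw [sub_self] at this
  refine this.congr fun z => ?_
  exact intervalIntegral.integral_interval_sub_left hF.intervalIntegrable hF.intervalIntegrable

theorem IsPrimitive.tendsto_zero {g h : ℝ → ℝ} (H : IsPrimitive g h) (hg : MemLp g 2)
    (hh : MemLp h 2) {l : Filter ℝ} (hl : l = atTop ∨ l = atBot) : Tendsto g l (𝓝 0) := by
  have h2 : Tendsto (fun z => g z ^ 2) l (𝓝 0) :=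
    tendsto_of_tendsto_of_tendsto_of_le_of_le tendsto_const_nhds
      (tendsto_integral_add_one ((hg.integrable_sq.const_mul 2).add hh.integrable_sq) hl)
      (fun z => sq_nonneg _) (fun z => H.sq_le hg hh z)
  have := (Real.continuous_sqrt.tendsto 0).comp h2
  rw [tendsto_zero_iff_abs_tendsto_zero]
  simpa [Function.comp_def, Real.sqrt_sq_eq_abs] using this

theorem IsPrimitive.integral_eq_zero {g h : ℝ → ℝ} (H : IsPrimitive g h) (hh : Integrable h)
    {c : ℝ} (hT : Tendsto g atTop (𝓝 c)) (hB : Tendsto g atBot (𝓝 c)) : ∫ x, h x = 0 := by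
  have h1 := intervalIntegral_tendsto_integral hh tendsto_neg_atTop_atBot tendsto_id
  refine tendsto_nhds_unique h1 ?_
  have := hT.sub (hB.comp tendsto_neg_atTop_atBot)
  rw [sub_self] at this
  exact this.congr fun z => (H.integral_eq_sub _ _).symm

theorem IsPrimitive.hasDerivAt {g h : ℝ → ℝ} (H : IsPrimitive g h) (hh : Continuous h) (z : ℝ) :
    HasDerivAt g (h z) z := by
  have e : g = fun y => g z + ∫ x in z..y, h x := by
    ext y; rw [H.integral_eq_sub]; ring
  rw [e]
  exact (intervalIntegral.integral_hasDerivAt_right (hh.intervalIntegrable _ _)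
    (hh.stronglyMeasurableAtFilter _ _) hh.continuousAt).const_add _

/-! ### Continuous representatives in H¹ and the maps from H² to H¹ -/

namespace Sobolev

theorem exists_rep (v : Sobolev 1) : ∃ g, v.1 0 =ᵐ[volume] g ∧ IsPrimitive g (v.1 1) :=
  (v.2 0).exists_isPrimitive

/-- The continuous representative of an element of `H¹`. -/
def rep (v : Sobolev 1) : ℝ → ℝ := (exists_rep v).choose

theorem rep_ae_eq (v : Sobolev 1) : v.1 0 =ᵐ[volume] rep v := (exists_rep v).choose_spec.1

theorem isPrimitive_rep (v : Sobolev 1) : IsPrimitive (rep v) (v.1 1) :=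
  (exists_rep v).choose_spec.2

theorem rep_eq_of_continuous (v : Sobolev 1) {g : ℝ → ℝ} (hg : Continuous g)
    (h : v.1 0 =ᵐ[volume] g) : rep v = g :=
  ((isPrimitive_rep v).continuous.ae_eq_iff_eq volume hg).1 ((rep_ae_eq v).symm.trans h)

theorem rep_add (v w : Sobolev 1) : rep (v + w) = rep v + rep w := by
  refine rep_eq_of_continuous _
    ((isPrimitive_rep v).continuous.add (isPrimitive_rep w).continuous) ?_
  filter_upwards [Lp.coeFn_add (v.1 0) (w.1 0), rep_ae_eq v, rep_ae_eq w] with x h1 h2 h3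
  rw [Pi.add_apply, ← h2, ← h3]
  exact h1

theorem rep_smul (c : ℝ) (v : Sobolev 1) : rep (c • v) = c • rep v := by
  refine rep_eq_of_continuous _ ((isPrimitive_rep v).continuous.const_smul c) ?_
  filter_upwards [Lp.coeFn_smul c (v.1 0), rep_ae_eq v] with x h1 h2
  rw [Pi.smul_apply, ← h2]
  exact h1

theorem memLp_rep (v : Sobolev 1) : MemLp (rep v) 2 :=
  (memLp_congr_ae (rep_ae_eq v)).1 (Lp.memLp _)

theorem memLp_one (v : Sobolev 1) : MemLp (v.1 1) 2 := Lp.memLp _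

theorem norm_sq_eq_integral (w : L2) : ‖w‖ ^ 2 = ∫ x, w x ^ 2 := by
  rw [← real_inner_self_eq_norm_sq, L2.inner_def]
  congr 1
  ext x
  simp [pow_two]

theorem norm_sq_eq (v : Sobolev 1) : ‖v‖ ^ 2 = (∫ x, rep v x ^ 2) + ∫ x, v.1 1 x ^ 2 := by
  have e : ∫ x, rep v x ^ 2 = ∫ x, v.1 0 x ^ 2 :=
    integral_congr_ae (by filter_upwards [rep_ae_eq v] with x hx; rw [hx])
  rw [e, Submodule.coe_norm, PiLp.norm_sq_eq_of_L2, Fin.sum_univ_two,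
    norm_sq_eq_integral, norm_sq_eq_integral]

theorem abs_rep_le (v : Sobolev 1) (z : ℝ) : |rep v z| ≤ 2 * ‖v‖ := by
  refine abs_le_of_sq_le_sq ?_ (by positivity)
  have := (isPrimitive_rep v).sq_le_integral (memLp_rep v) (memLp_one v) z
  rw [← norm_sq_eq] at this
  -- The bound at hand is 2‖v‖²; it is relaxed to (2‖v‖)² to avoid √2.
  nlinarith [sq_nonneg ‖v‖]

theorem tendsto_rep (v : Sobolev 1) {l : Filter ℝ} (hl : l = atTop ∨ l = atBot) :
    Tendsto (rep v) l (𝓝 0) :=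
  (isPrimitive_rep v).tendsto_zero (memLp_rep v) (memLp_one v) hl

/-- Evaluation of the continuous representative at a point. -/
def eval (z : ℝ) : Sobolev 1 →L[ℝ] ℝ :=
  LinearMap.mkContinuous
    { toFun := fun v => rep v z
      map_add' := fun v w => by rw [rep_add]; rfl
      map_smul' := fun c v => by rw [rep_smul]; rfl } 2 fun v => abs_rep_le v z

/-- The linear map `H² → H¹` that selects two consecutive derivatives. -/
def select (ι : Fin 2 → Fin 3) (hι : ∀ v : Sobolev 2, IsWeakDeriv (v.1 (ι 0)) (v.1 (ι 1))) :
    Sobolev 2 →ₗ[ℝ] Sobolev 1 where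
  toFun v := ⟨WithLp.toLp 2 fun j => v.1 (ι j), fun j => by
    rw [Subsingleton.elim j 0]; exact hι v⟩
  map_add' v w := by
    refine Subtype.ext (PiLp.ext fun j => ?_)
    simp only [Submodule.coe_add, PiLp.add_apply]
  map_smul' c v := by
    refine Subtype.ext (PiLp.ext fun j => ?_)
    simp only [SetLike.val_smul, PiLp.smul_apply, RingHom.id_apply]

theorem norm_sq_three (v : Sobolev 2) : ‖v‖ ^ 2 = ‖v.1 0‖ ^ 2 + ‖v.1 1‖ ^ 2 + ‖v.1 2‖ ^ 2 := by
  rw [Submodule.coe_norm, PiLp.norm_sq_eq_of_L2, Fin.sum_univ_three]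

theorem norm_sq_two (v : Sobolev 1) : ‖v‖ ^ 2 = ‖v.1 0‖ ^ 2 + ‖v.1 1‖ ^ 2 := by
  rw [Submodule.coe_norm, PiLp.norm_sq_eq_of_L2, Fin.sum_univ_two]

theorem isWeakDeriv_zero_one (v : Sobolev 2) : IsWeakDeriv (v.1 0) (v.1 1) := v.2 0

theorem isWeakDeriv_one_two (v : Sobolev 2) : IsWeakDeriv (v.1 1) (v.1 2) := v.2 1

/-- The embedding `H² → H¹`. -/
def lower : Sobolev 2 →L[ℝ] Sobolev 1 :=
  (select ![0, 1] isWeakDeriv_zero_one).mkContinuous 1 fun v => by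
    rw [one_mul]
    refine le_of_sq_le_sq ?_ (norm_nonneg _)
    rw [norm_sq_two, norm_sq_three]
    exact le_add_of_nonneg_right (sq_nonneg _)

/-- The weak derivative as a map `H² → H¹`. -/
def derivative : Sobolev 2 →L[ℝ] Sobolev 1 :=
  (select ![1, 2] isWeakDeriv_one_two).mkContinuous 1 fun v => by
    rw [one_mul]
    refine le_of_sq_le_sq ?_ (norm_nonneg _)
    rw [norm_sq_two, norm_sq_three, add_assoc]
    exact le_add_of_nonneg_left (sq_nonneg _)

theorem lower_one (v : Sobolev 2) : (lower v).1 1 = v.1 1 := rfl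
theorem derivative_zero (v : Sobolev 2) : (derivative v).1 0 = v.1 1 := rfl

/-- In H² the weak derivative itself has a continuous representative, so the almost everywhere
derivative becomes classical. -/
theorem hasDerivAt_rep_lower (v : Sobolev 2) (z : ℝ) :
    HasDerivAt (rep (lower v)) (rep (derivative v) z) z :=
  ((isPrimitive_rep (lower v)).congr_deriv (rep_ae_eq (derivative v))).hasDerivAt
    (isPrimitive_rep (derivative v)).continuous z

end Sobolev

/-! ### The nonlinearities and their Taylor bounds on compact intervals -/

theorem hasDerivAt_multiplier (n m : ℝ) {a : ℝ} (ha : 0 < a) :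
    HasDerivAt (multiplier n m) (a ^ (-n - m)) a := by
  by_cases h1 : n + m = 1
  · have e : multiplier n m = Real.log := by ext x; rw [multiplier, if_pos h1]
    rw [e, show -n - m = -1 by linarith, Real.rpow_neg_one]
    exact Real.hasDerivAt_log ha.ne'
  · have e : multiplier n m = fun x => (1 - x ^ (1 - n - m)) / (n + m - 1) := by
      ext x; rw [multiplier, if_neg h1]
    have h1' : n + m - 1 ≠ 0 := sub_ne_zero.2 h1
    rw [e]
    refine (((Real.hasDerivAt_rpow_const (p := 1 - n - m) (Or.inl ha.ne')).const_sub 1).div_const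
      (n + m - 1)).congr_deriv ?_
    rw [show 1 - n - m - 1 = -n - m by ring]
    field_simp
    ring

/-- With `multiplier_one` and `potential_one` this shows that V vanishes to second order at 1, so
that V(φ) is integrable as soon as φ - 1 is bounded and square integrable, with φ bounded away from
0. -/
theorem hasDerivAt_potential (n m : ℝ) {a : ℝ} (ha : 0 < a) :
    HasDerivAt (potential n m) (multiplier n m a) a := by
  by_cases h1 : n + m = 1
  · have e : potential n m = fun x => x * Real.log x - x + 1 := by
      ext x; rw [potential, if_pos h1]
    rw [e, multiplier, if_pos h1]
    refine (((Real.hasDerivAt_mul_log ha.ne').sub (hasDerivAt_id a)).add_const 1).congr_deriv ?_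
    ring
  by_cases h2 : n + m = 2
  · have e : potential n m = fun x => -Real.log x + x - 1 := by
      ext x; rw [potential, if_neg h1, if_pos h2]
    rw [e, multiplier, if_neg h1, show 1 - n - m = -1 by linarith, Real.rpow_neg_one, h2]
    refine (((Real.hasDerivAt_log ha.ne').neg.add (hasDerivAt_id a)).sub_const 1).congr_deriv ?_
    ring
  · have e : potential n m = fun x =>
        (x ^ (2 - n - m) - 1 + (n + m - 2) * (x - 1)) / ((n + m - 1) * (n + m - 2)) := by
      ext x; rw [potential, if_neg h1, if_neg h2]
    have h1' : n + m - 1 ≠ 0 := sub_ne_zero.2 h1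
    have h2' : n + m - 2 ≠ 0 := sub_ne_zero.2 h2
    rw [e, multiplier, if_neg h1]
    refine ((((Real.hasDerivAt_rpow_const (p := 2 - n - m) (Or.inl ha.ne')).sub_const 1).add
      (((hasDerivAt_id a).sub_const 1).const_mul (n + m - 2))).div_const _).congr_deriv ?_
    rw [show 2 - n - m - 1 = 1 - n - m by ring]
    field_simp
    ring

theorem multiplier_one (n m : ℝ) : multiplier n m 1 = 0 := by
  rw [multiplier]; split_ifs <;> simp

theorem potential_one (n m : ℝ) : potential n m 1 = 0 := by
  rw [potential]; split_ifs <;> simp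

theorem continuousOn_rpow (p : ℝ) : ContinuousOn (fun x : ℝ => x ^ p) (Ioi 0) :=
  fun _ hx => (Real.continuousAt_rpow_const _ _ (Or.inl (ne_of_gt hx))).continuousWithinAt

theorem hasDerivAt_rpow (p : ℝ) {a : ℝ} (ha : 0 < a) :
    HasDerivAt (fun x : ℝ => x ^ p) (p * a ^ (p - 1)) a :=
  Real.hasDerivAt_rpow_const (Or.inl ha.ne')

theorem exists_bound_Icc {F : ℝ → ℝ} {c : ℝ} (hc : 0 < c) (d : ℝ) (hF : ContinuousOn F (Ioi 0)) :
    ∃ C, 0 ≤ C ∧ ∀ a ∈ Icc c d, |F a| ≤ C := by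
  obtain ⟨C, hC⟩ := isCompact_Icc.exists_bound_of_continuousOn
    (hF.mono fun x (hx : x ∈ Icc c d) => hc.trans_le hx.1)
  exact ⟨|C|, abs_nonneg _, fun a ha => (hC a ha).trans (le_abs_self _)⟩

theorem exists_lipschitz_Icc {F F' : ℝ → ℝ} {c : ℝ} (hc : 0 < c) (d : ℝ)
    (hF : ∀ a, 0 < a → HasDerivAt F (F' a) a) (hF' : ContinuousOn F' (Ioi 0)) :
    ∃ C, 0 ≤ C ∧ ∀ a ∈ Icc c d, ∀ x ∈ Icc c d, |F x - F a| ≤ C * |x - a| := by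
  obtain ⟨C, hC0, hC⟩ := exists_bound_Icc hc d hF'
  exact ⟨C, hC0, fun a ha x hx => (convex_Icc c d).norm_image_sub_le_of_norm_hasDerivWithin_le
    (fun y hy => (hF y (hc.trans_le hy.1)).hasDerivWithinAt) hC ha hx⟩

/-- The mean value inequality for F y - F'(a) y, whose derivative F' y - F' a is at most C |x - a|
between a and x. -/
theorem exists_taylor_Icc {F F' F'' : ℝ → ℝ} {c : ℝ} (hc : 0 < c) (d : ℝ)
    (hF : ∀ a, 0 < a → HasDerivAt F (F' a) a) (hF' : ∀ a, 0 < a → HasDerivAt F' (F'' a) a)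
    (hF'' : ContinuousOn F'' (Ioi 0)) :
    ∃ C, 0 ≤ C ∧ ∀ a ∈ Icc c d, ∀ x ∈ Icc c d,
      |F x - F a - F' a * (x - a)| ≤ C * (x - a) ^ 2 := by
  obtain ⟨C, hC0, hC⟩ := exists_lipschitz_Icc hc d hF' hF''
  refine ⟨C, hC0, fun a ha x hx => ?_⟩
  have hsub : uIcc a x ⊆ Icc c d := uIcc_subset_Icc ha hx
  have key := (convex_uIcc a x).norm_image_sub_le_of_norm_hasDerivWithin_le
    (f := fun y => F y - F' a * y) (f' := fun y => F' y - F' a) (C := C * |x - a|)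
    (fun y hy => by
      have := (hF y (hc.trans_le (hsub hy).1)).sub ((hasDerivAt_id y).const_mul (F' a))
      exact (this.congr_deriv (by simp)).hasDerivWithinAt)
    (fun y hy => (hC a ha y (hsub hy)).trans
      (mul_le_mul_of_nonneg_left (abs_sub_left_of_mem_uIcc hy) hC0)) left_mem_uIcc right_mem_uIcc
  rw [Real.norm_eq_abs, Real.norm_eq_abs, mul_assoc, abs_mul_abs_self] at key
  convert key using 2 <;> ring

theorem continuousOn_potential (n m : ℝ) : ContinuousOn (potential n m) (Ioi 0) :=
  fun _ hx => (hasDerivAt_potential n m hx).continuousAt.continuousWithinAt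

/-! ### The energy as a differentiable functional on H¹ -/

namespace Sobolev

/-- The function `1 + v`, for `v` in `H¹`. -/
def oneAdd (v : Sobolev 1) (z : ℝ) : ℝ := 1 + rep v z

theorem oneAdd_sub_one (v : Sobolev 1) (z : ℝ) : oneAdd v z - 1 = rep v z :=
  add_sub_cancel_left _ _

theorem isPrimitive_oneAdd (v : Sobolev 1) : IsPrimitive (oneAdd v) (v.1 1) :=
  ((IsPrimitive.const 1).add (isPrimitive_rep v)).congr_deriv (ae_of_all _ fun _ => zero_add _)

theorem continuous_oneAdd (v : Sobolev 1) : Continuous (oneAdd v) :=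
  (isPrimitive_oneAdd v).continuous

theorem tendsto_oneAdd (v : Sobolev 1) {l : Filter ℝ} (hl : l = atTop ∨ l = atBot) :
    Tendsto (oneAdd v) l (𝓝 1) := by
  have := (tendsto_rep v hl).const_add 1
  rwa [add_zero] at this

/-- The profile tends to 1 at both ends, so it exceeds 1/2 off a compact interval, and on that
interval it has a positive minimum. All powers of the profile are therefore bounded. The interval
contains 1, so that expansions can start there. -/
theorem exists_oneAdd_mem_Icc (v : Sobolev 1) (hv : ∀ z, 0 < oneAdd v z) :
    ∃ c d, 0 < c ∧ c ≤ 1 ∧ 1 ≤ d ∧ ∀ z, oneAdd v z ∈ Icc c d := by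
  have h1 := (tendsto_oneAdd v (Or.inl rfl)).eventually (lt_mem_nhds (by norm_num : (1 / 2 : ℝ) < 1))
  have h2 := (tendsto_oneAdd v (Or.inr rfl)).eventually (lt_mem_nhds (by norm_num : (1 / 2 : ℝ) < 1))
  obtain ⟨R, hR⟩ := eventually_atTop.1 h1
  obtain ⟨S, hS⟩ := eventually_atBot.1 h2
  obtain ⟨p, -, hp⟩ := isCompact_uIcc.exists_isMinOn (nonempty_uIcc (a := S) (b := R))
    (continuous_oneAdd v).continuousOn
  refine ⟨min (1 / 2) (oneAdd v p), 1 + 2 * ‖v‖, lt_min (by norm_num) (hv p),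
    (min_le_left _ _).trans (by norm_num), by simp, fun z => ⟨?_, ?_⟩⟩
  · rcases le_total z S with h | h
    · exact (min_le_left _ _).trans (hS z h).le
    rcases le_total R z with h' | h'
    · exact (min_le_left _ _).trans (hR z h').le
    · refine (min_le_right _ _).trans (hp ?_)
      rw [uIcc_of_le (h.trans h')]
      exact ⟨h, h'⟩
  · have := (le_abs_self _).trans (abs_rep_le v z)
    simp only [oneAdd]; linarith

variable {n m c d : ℝ} {v : Sobolev 1}

theorem continuous_comp_oneAdd {F : ℝ → ℝ} (hF : ContinuousOn F (Ioi 0))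
    (hv : ∀ z, 0 < oneAdd v z) : Continuous fun z => F (oneAdd v z) :=
  hF.comp_continuous (continuous_oneAdd v) hv

theorem memLp_mul {F g : ℝ → ℝ} {p : ENNReal} (hF : ContinuousOn F (Ioi 0))
    (hv : ∀ z, 0 < oneAdd v z) (hg : MemLp g p) : MemLp (fun z => F (oneAdd v z) * g z) p := by
  obtain ⟨c, d, hc, -, -, hcd⟩ := exists_oneAdd_mem_Icc v hv
  obtain ⟨C, -, hC⟩ := exists_bound_Icc hc d hF
  refine hg.of_le_mul (c := C)
    ((continuous_comp_oneAdd hF hv).aestronglyMeasurable.mul hg.1) (ae_of_all _ fun z => ?_)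
  rw [norm_mul]
  exact mul_le_mul_of_nonneg_right (hC _ (hcd z)) (norm_nonneg _)

theorem integrable_mul {F g : ℝ → ℝ} (hF : ContinuousOn F (Ioi 0))
    (hv : ∀ z, 0 < oneAdd v z) (hg : Integrable g) :
    Integrable (fun z => F (oneAdd v z) * g z) :=
  memLp_one_iff_integrable.1 (memLp_mul hF hv (memLp_one_iff_integrable.2 hg))

theorem memLp_comp {F F' : ℝ → ℝ} (hF : ∀ a, 0 < a → HasDerivAt F (F' a) a)
    (hF' : ContinuousOn F' (Ioi 0)) (hv : ∀ z, 0 < oneAdd v z) :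
    MemLp (fun z => F (oneAdd v z) - F 1) 2 := by
  obtain ⟨c, d, hc, hc1, hd1, hcd⟩ := exists_oneAdd_mem_Icc v hv
  obtain ⟨C, -, hC⟩ := exists_lipschitz_Icc hc d hF hF'
  have hFc : ContinuousOn F (Ioi 0) := fun a ha => (hF a ha).continuousAt.continuousWithinAt
  refine (memLp_rep v).of_le_mul (c := C)
    ((continuous_comp_oneAdd hFc hv).sub continuous_const).aestronglyMeasurable
    (ae_of_all _ fun z => ?_)
  have := hC 1 ⟨hc1, hd1⟩ _ (hcd z)
  rwa [oneAdd_sub_one] at this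

theorem memLp_multiplier (n m : ℝ) (hv : ∀ z, 0 < oneAdd v z) :
    MemLp (fun z => multiplier n m (oneAdd v z)) 2 := by
  simpa [multiplier_one] using
    memLp_comp (fun a ha => hasDerivAt_multiplier n m ha) (continuousOn_rpow _) hv

theorem integrable_potential (n m : ℝ) (hv : ∀ z, 0 < oneAdd v z) :
    Integrable (fun z => potential n m (oneAdd v z)) := by
  obtain ⟨c, d, hc, hc1, hd1, hcd⟩ := exists_oneAdd_mem_Icc v hv
  obtain ⟨C, -, hC⟩ := exists_taylor_Icc hc d (fun a ha => hasDerivAt_potential n m ha)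
    (fun a ha => hasDerivAt_multiplier n m ha) (continuousOn_rpow _)
  refine ((memLp_rep v).integrable_sq.const_mul C).mono'
    (continuous_comp_oneAdd (continuousOn_potential n m) hv).aestronglyMeasurable
    (ae_of_all _ fun z => ?_)
  have := hC 1 ⟨hc1, hd1⟩ _ (hcd z)
  rwa [potential_one, multiplier_one, zero_mul, sub_zero, sub_zero,
    oneAdd_sub_one] at this

theorem integrable_energyDensity (n m : ℝ) (hv : ∀ z, 0 < oneAdd v z) :
    Integrable fun z => energyDensity n m (oneAdd v z) (v.1 1 z) := by
  have h1 := (integrable_mul (continuousOn_rpow (-2 * m)) hv (memLp_one v).integrable_sq).const_mul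
    (1 / 2)
  refine (h1.add (integrable_potential n m hv)).congr (ae_of_all _ fun z => ?_)
  simp only [Pi.add_apply, energyDensity]
  ring

/-- The energy as a functional on `H¹`. -/
def energyFunctional (n m : ℝ) (v : Sobolev 1) : ℝ :=
  ∫ z, energyDensity n m (oneAdd v z) (v.1 1 z)

theorem integrable_mul_rep {g : ℝ → ℝ} (hg : Integrable g) (w : Sobolev 1) :
    Integrable fun z => g z * rep w z :=
  hg.mul_bdd (c := 2 * ‖w‖) (isPrimitive_rep w).continuous.aestronglyMeasurable
    (ae_of_all _ (abs_rep_le w))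

/-- The functional `w ↦ ∫ g w` on `H¹` for integrable `g`. -/
def integralMul (g : ℝ → ℝ) (hg : Integrable g) : Sobolev 1 →L[ℝ] ℝ :=
  have hi := integrable_mul_rep hg
  LinearMap.mkContinuous
    { toFun := fun w => ∫ z, g z * rep w z
      map_add' := fun v w => by
        rw [← integral_add (hi v) (hi w)]
        simp only [rep_add, Pi.add_apply, mul_add]
      map_smul' := fun c w => by
        simp only [rep_smul, Pi.smul_apply, smul_eq_mul, RingHom.id_apply, ← integral_const_mul]
        congr 1; ext z; ring } (2 * ∫ z, |g z|) fun w => by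
    refine (norm_integral_le_integral_norm _).trans ?_
    rw [mul_comm 2, mul_assoc, ← integral_mul_const]
    refine integral_mono (hi w).norm (hg.abs.mul_const _) fun z => ?_
    simp only [norm_mul, Real.norm_eq_abs]
    exact mul_le_mul_of_nonneg_left (abs_rep_le w z) (abs_nonneg _)

/-- The functional `w ↦ ∫ g w^(j)` on `H¹` for square integrable `g`. -/
def integralMulDeriv (j : Fin 2) (g : ℝ → ℝ) (hg : MemLp g 2) : Sobolev 1 →L[ℝ] ℝ :=
  (innerSL ℝ (hg.toLp g)).comp ((PiLp.proj 2 (fun _ : Fin 2 => L2) j).comp (Sobolev 1).subtypeL)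

theorem integralMulDeriv_apply (j : Fin 2) (g : ℝ → ℝ) (hg : MemLp g 2) (w : Sobolev 1) :
    integralMulDeriv j g hg w = ∫ z, g z * w.1 j z := by
  change inner ℝ (hg.toLp g) (w.1 j) = _
  rw [L2.inner_def]
  refine integral_congr_ae ?_
  filter_upwards [hg.coeFn_toLp] with z hz
  simp [hz, mul_comm]

theorem memLp_rpow_mul (p : ℝ) (hv : ∀ z, 0 < oneAdd v z) {g : ℝ → ℝ} (hg : MemLp g 2) :
    MemLp (fun z => oneAdd v z ^ p * g z) 2 :=
  memLp_mul (continuousOn_rpow p) hv hg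

theorem integrable_kinetic (m : ℝ) (hv : ∀ z, 0 < oneAdd v z) :
    Integrable fun z => -m * oneAdd v z ^ (-2 * m - 1) * v.1 1 z ^ 2 :=
  integrable_mul (continuousOn_const.mul (continuousOn_rpow _)) hv (memLp_one v).integrable_sq

/-- The derivative of the energy functional. -/
def energyDeriv (n m : ℝ) (v : Sobolev 1) (hv : ∀ z, 0 < oneAdd v z) : Sobolev 1 →L[ℝ] ℝ :=
  -- The first coefficient contains φ_z², which is only integrable, and is paired with the bounded
  -- function w; the other two pairings are L² inner products.
  integralMul _ (integrable_kinetic m hv) + integralMulDeriv 0 _ (memLp_multiplier n m hv)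
    + integralMulDeriv 1 _ (memLp_rpow_mul (-2 * m) hv (memLp_one v))

/-- The density of the derivative of the energy functional. -/
def energyDerivDensity (n m : ℝ) (v w : Sobolev 1) (z : ℝ) : ℝ :=
  -m * oneAdd v z ^ (-2 * m - 1) * v.1 1 z ^ 2 * rep w z
    + multiplier n m (oneAdd v z) * rep w z + oneAdd v z ^ (-2 * m) * v.1 1 z * w.1 1 z

theorem integrable_energyDerivDensity (n m : ℝ) (hv : ∀ z, 0 < oneAdd v z) (w : Sobolev 1) :
    Integrable (energyDerivDensity n m v w) :=
  ((integrable_mul_rep (integrable_kinetic m hv) w).add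
    ((memLp_multiplier n m hv).integrable_mul (memLp_rep w))).add
    ((memLp_rpow_mul (-2 * m) hv (memLp_one v)).integrable_mul (memLp_one w))

theorem energyDeriv_apply (n m : ℝ) (hv : ∀ z, 0 < oneAdd v z) (w : Sobolev 1) :
    energyDeriv n m v hv w = ∫ z, energyDerivDensity n m v w z := by
  have i1 := integrable_mul_rep (integrable_kinetic m hv) w
  have i2 := (memLp_multiplier n m hv).integrable_mul (memLp_rep w)
  have i3 := (memLp_rpow_mul (-2 * m) hv (memLp_one v)).integrable_mul (memLp_one w)
  have e2 : ∫ z, multiplier n m (oneAdd v z) * w.1 0 z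
      = ∫ z, multiplier n m (oneAdd v z) * rep w z :=
    integral_congr_ae (by filter_upwards [rep_ae_eq w] with z hz; rw [hz])
  have h1 : integralMul _ (integrable_kinetic m hv) w
      = ∫ z, -m * oneAdd v z ^ (-2 * m - 1) * v.1 1 z ^ 2 * rep w z := rfl
  have h := integral_add (i1.add i2) i3
  have h' := integral_add i1 i2
  simp only [Pi.add_apply, Pi.mul_apply] at h h'
  rw [energyDeriv, _root_.add_apply, _root_.add_apply,
    integralMulDeriv_apply, integralMulDeriv_apply, e2, h1, ← h', ← h]
  rfl

/-- The constant must not depend on b = φ_z, which is unbounded in H¹. The density is quadratic in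
b, so the remainder splits exactly into Taylor remainders and increments of x^{-2m} times b² and bβ,
a term in β², and the Taylor remainder of the potential. -/
theorem exists_energyDensity_taylor (n m : ℝ) {c : ℝ} (hc : 0 < c) (d : ℝ) :
    ∃ K, 0 ≤ K ∧ ∀ a ∈ Icc c d, ∀ x ∈ Icc c d, ∀ b β : ℝ,
      |energyDensity n m x (b + β) - energyDensity n m a b
        - (-m * a ^ (-2 * m - 1) * b ^ 2 * (x - a) + multiplier n m a * (x - a)
          + a ^ (-2 * m) * b * β)| ≤ K * ((x - a) ^ 2 * b ^ 2 + β ^ 2 + (x - a) ^ 2) := by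
  have hcr (k p : ℝ) : ContinuousOn (fun x : ℝ => k * x ^ p) (Ioi 0) :=
    continuousOn_const.mul (continuousOn_rpow _)
  obtain ⟨C₁, h₁, H₁⟩ := exists_taylor_Icc hc d (fun a ha => hasDerivAt_rpow (-2 * m) ha)
    (fun a ha => (hasDerivAt_rpow (-2 * m - 1) ha).const_mul (-2 * m))
    (continuousOn_const.mul (hcr _ _))
  obtain ⟨C₂, h₂, H₂⟩ := exists_lipschitz_Icc hc d (fun a ha => hasDerivAt_rpow (-2 * m) ha)
    (hcr _ _)
  obtain ⟨C₃, h₃, H₃⟩ := exists_bound_Icc hc d (continuousOn_rpow (-2 * m))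
  obtain ⟨C₄, h₄, H₄⟩ := exists_taylor_Icc hc d (fun a ha => hasDerivAt_potential n m ha)
    (fun a ha => hasDerivAt_multiplier n m ha) (continuousOn_rpow _)
  refine ⟨C₁ + C₂ + C₃ + C₄, by positivity, fun a ha x hx b β => ?_⟩
  have k₁ := H₁ a ha x hx
  have k₂ := H₂ a ha x hx
  have k₃ := H₃ x hx
  have k₄ := H₄ a ha x hx
  set α := x - a
  have e : energyDensity n m x (b + β) - energyDensity n m a b
        - (-m * a ^ (-2 * m - 1) * b ^ 2 * α + multiplier n m a * α + a ^ (-2 * m) * b * β)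
      = (x ^ (-2 * m) - a ^ (-2 * m) - -2 * m * a ^ (-2 * m - 1) * α) * (1 / 2 * b ^ 2)
        + (x ^ (-2 * m) - a ^ (-2 * m)) * (b * β) + x ^ (-2 * m) * (1 / 2 * β ^ 2)
        + (potential n m x - potential n m a - multiplier n m a * α) := by
    simp only [energyDensity]; ring
  rw [e]
  refine (abs_add_le _ _).trans ((add_le_add_left ((abs_add_le _ _).trans
    (add_le_add_left (abs_add_le _ _) _)) _).trans ?_)
  rw [abs_mul _ (1 / 2 * b ^ 2), abs_mul _ (b * β), abs_mul _ (1 / 2 * β ^ 2),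
    abs_of_nonneg (by positivity : 0 ≤ 1 / 2 * b ^ 2),
    abs_of_nonneg (by positivity : 0 ≤ 1 / 2 * β ^ 2)]
  have j₁ := mul_le_mul_of_nonneg_right k₁ (by positivity : 0 ≤ 1 / 2 * b ^ 2)
  have j₂ := mul_le_mul_of_nonneg_right k₂ (abs_nonneg (b * β))
  have j₃ := mul_le_mul_of_nonneg_right k₃ (by positivity : 0 ≤ 1 / 2 * β ^ 2)
  have j₂' : |α| * |b * β| ≤ α ^ 2 * b ^ 2 + β ^ 2 := by
    rw [← abs_mul]
    refine abs_le.2 ⟨?_, ?_⟩ <;> nlinarith [sq_nonneg (α * b + β), sq_nonneg (α * b - β)]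
  have j₂'' := mul_le_mul_of_nonneg_left j₂' h₂
  -- Surplus products: the sum of the four constants multiplies all three squares.
  have p₁ : 0 ≤ C₁ * β ^ 2 := by positivity
  have p₂ : 0 ≤ C₁ * (α ^ 2 * b ^ 2) := by positivity
  have p₃ : 0 ≤ C₃ * (α ^ 2 * b ^ 2) := by positivity
  have p₄ : 0 ≤ C₃ * β ^ 2 := by positivity
  have p₅ : 0 ≤ C₄ * (α ^ 2 * b ^ 2) := by positivity
  have p₆ : 0 ≤ C₄ * β ^ 2 := by positivity
  have p₇ : 0 ≤ C₁ * α ^ 2 := by positivity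
  have p₈ : 0 ≤ C₂ * α ^ 2 := by positivity
  have p₉ : 0 ≤ C₃ * α ^ 2 := by positivity
  linarith

theorem coeFn_add_one (v w : Sobolev 1) :
    (v + w).1 1 =ᵐ[volume] fun z => v.1 1 z + w.1 1 z :=
  Lp.coeFn_add (v.1 1) (w.1 1)

theorem exists_energyFunctional_taylor (n m : ℝ) (hv : ∀ z, 0 < oneAdd v z) :
    ∃ K ρ, 0 < ρ ∧ ∀ w : Sobolev 1, ‖w‖ ≤ ρ →
      |energyFunctional n m (v + w) - energyFunctional n m v - energyDeriv n m v hv w|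
        ≤ K * ‖w‖ ^ 2 := by
  obtain ⟨c, d, hc, hc1, hd1, hcd⟩ := exists_oneAdd_mem_Icc v hv
  obtain ⟨K, hK0, hK⟩ := exists_energyDensity_taylor n m (half_pos hc) (d + c)
  -- If ‖w‖ ≤ c/4, then |w| ≤ c/2 pointwise and 1 + v + w stays in [c/2, d + c]. The factor 4 ∫ v_z²
  -- comes from w² ≤ 4‖w‖² in the term w² v_z²; the 1 comes from ∫ w_z² + ∫ w² = ‖w‖².
  refine ⟨K * (4 * (∫ x, v.1 1 x ^ 2) + 1), c / 4, by positivity, fun w hw => ?_⟩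
  have hα (z : ℝ) : |rep w z| ≤ 2 * ‖w‖ := abs_rep_le w z
  have hadd (z : ℝ) : oneAdd (v + w) z = oneAdd v z + rep w z := by
    simp only [oneAdd, rep_add, Pi.add_apply]; ring
  have hmem (z : ℝ) : oneAdd (v + w) z ∈ Icc (c / 2) (d + c) := by
    have h1 := abs_le.1 ((hα z).trans (by linarith : 2 * ‖w‖ ≤ c / 2))
    have h2 := hcd z
    rw [hadd]
    exact ⟨by linarith [h1.1, h2.1], by linarith [h1.2, h2.2]⟩
  have hmem' (z : ℝ) : oneAdd v z ∈ Icc (c / 2) (d + c) :=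
    ⟨by linarith [(hcd z).1], by linarith [(hcd z).2]⟩
  have i1 := integrable_energyDensity n m (v := v + w) fun z => (half_pos hc).trans_le (hmem z).1
  have i2 := integrable_energyDensity n m hv
  have i3 := integrable_energyDerivDensity n m hv w
  have s1 := (memLp_one v).integrable_sq
  have s2 := (memLp_one w).integrable_sq
  have s3 := (memLp_rep w).integrable_sq
  have e := integral_sub (i1.sub i2) i3
  have e' := integral_sub i1 i2
  simp only [Pi.sub_apply] at e e'
  rw [energyFunctional, energyFunctional, energyDeriv_apply, ← e', ← e]
  have b1 : Integrable fun z => K * (4 * ‖w‖ ^ 2 * v.1 1 z ^ 2 + w.1 1 z ^ 2 + rep w z ^ 2) :=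
    (((s1.const_mul _).add s2).add s3).const_mul K
  rw [← Real.norm_eq_abs]
  refine (norm_integral_le_of_norm_le b1 ?_).trans (le_of_eq ?_)
  · filter_upwards [coeFn_add_one v w] with z hz
    have := hK _ (hmem' z) _ (hmem z) (v.1 1 z) (w.1 1 z)
    rw [hadd z, add_sub_cancel_left, ← hadd z] at this
    rw [hz, Real.norm_eq_abs]
    refine this.trans (mul_le_mul_of_nonneg_left ?_ hK0)
    have h2 : rep w z ^ 2 ≤ 4 * ‖w‖ ^ 2 := by
      have := sq_le_sq' (abs_le.1 (hα z)).1 (abs_le.1 (hα z)).2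
      linarith
    have := mul_le_mul_of_nonneg_right h2 (sq_nonneg (v.1 1 z))
    linarith
  · have a1 := integral_add ((s1.const_mul (4 * ‖w‖ ^ 2)).add s2) s3
    have a2 := integral_add (s1.const_mul (4 * ‖w‖ ^ 2)) s2
    simp only [Pi.add_apply] at a1 a2
    rw [integral_const_mul, a1, a2, integral_const_mul]
    have := norm_sq_eq w
    nlinarith

theorem hasFDerivAt_energyFunctional (n m : ℝ) (hv : ∀ z, 0 < oneAdd v z) :
    HasFDerivAt (energyFunctional n m) (energyDeriv n m v hv) v := by
  obtain ⟨K, ρ, hρ, H⟩ := exists_energyFunctional_taylor n m hv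
  rw [hasFDerivAt_iff_isLittleO_nhds_zero]
  have h1 : (fun w => energyFunctional n m (v + w) - energyFunctional n m v
      - energyDeriv n m v hv w) =O[𝓝 0] fun w : Sobolev 1 => ‖w‖ ^ 2 := by
    refine Asymptotics.IsBigO.of_bound K ?_
    filter_upwards [Metric.closedBall_mem_nhds (0 : Sobolev 1) hρ] with w hw
    simpa using H w (by simpa using hw)
  exact h1.trans_isLittleO (Asymptotics.isLittleO_norm_pow_id one_lt_two)

end Sobolev

/-! ### The derivative of the energy vanishes along the flow -/

/-- The primitive of `x ^ (-m)` that enters the energy flux. -/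
def fluxPrimitive (m x : ℝ) : ℝ := if m = 1 then Real.log x else x ^ (1 - m) / (1 - m)

theorem hasDerivAt_fluxPrimitive (m : ℝ) {a : ℝ} (ha : 0 < a) :
    HasDerivAt (fluxPrimitive m) (a ^ (-m)) a := by
  by_cases h1 : m = 1
  · have e : fluxPrimitive m = Real.log := by ext x; rw [fluxPrimitive, if_pos h1]
    rw [e, h1, Real.rpow_neg_one]
    exact Real.hasDerivAt_log ha.ne'
  · have e : fluxPrimitive m = fun x => x ^ (1 - m) / (1 - m) := by
      ext x; rw [fluxPrimitive, if_neg h1]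
    have h1' : 1 - m ≠ 0 := sub_ne_zero.2 (Ne.symm h1)
    rw [e]
    refine ((hasDerivAt_rpow (1 - m) ha).div_const (1 - m)).congr_deriv ?_
    rw [show 1 - m - 1 = -m by ring]
    field_simp

namespace Sobolev

variable {n m : ℝ} {v : Sobolev 1}

/-- The magma equation, in weak form, for the spatial profile `1 + v` and `u = φ^{-m} φ_t`. -/
def IsEllipticSolution (n m : ℝ) (v u : Sobolev 1) : Prop :=
  ∀ ψ : ℝ → ℝ, ContDiff ℝ ∞ ψ → HasCompactSupport ψ →
    ∫ z, (oneAdd v z ^ n * u.1 1 z * deriv ψ z + oneAdd v z ^ m * u.1 0 z * ψ z)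
      = ∫ z, oneAdd v z ^ n * deriv ψ z

/-- The weak equation says exactly that φ^n - φ^n u_z has weak derivative -φ^m u. So the flux is
more regular than u_z alone, and W(φ) J may be differentiated by the product rule. -/
theorem IsEllipticSolution.exists_flux {u : Sobolev 1} (H : IsEllipticSolution n m v u)
    (hv : ∀ z, 0 < oneAdd v z) :
    ∃ J, (fun z => oneAdd v z ^ n - oneAdd v z ^ n * u.1 1 z) =ᵐ[volume] J ∧
      IsPrimitive J fun z => -(oneAdd v z ^ m * rep u z) := by
  have l1 : LocallyIntegrable fun z => oneAdd v z ^ n :=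
    (continuous_comp_oneAdd (continuousOn_rpow n) hv).locallyIntegrable
  have l2 : LocallyIntegrable fun z => oneAdd v z ^ n * u.1 1 z :=
    (memLp_rpow_mul n hv (memLp_one u)).locallyIntegrable (by norm_num)
  have l3 : LocallyIntegrable fun z => oneAdd v z ^ m * rep u z :=
    (memLp_rpow_mul m hv (memLp_rep u)).locallyIntegrable (by norm_num)
  refine IsWeakDeriv.exists_isPrimitive ⟨l1.sub l2, l3.neg, fun ψ hψ hc => ?_⟩
  have hd : Continuous (deriv ψ) := hψ.continuous_deriv (by simp)
  have i1 := integrable_mul_test l1 hd hc.deriv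
  have i2 := integrable_mul_test l2 hd hc.deriv
  have i3 := integrable_mul_test l3 hψ.continuous hc
  have h := H ψ hψ hc
  have e : ∫ z, (oneAdd v z ^ n * u.1 1 z * deriv ψ z + oneAdd v z ^ m * u.1 0 z * ψ z)
      = ∫ z, (oneAdd v z ^ n * u.1 1 z * deriv ψ z + oneAdd v z ^ m * rep u z * ψ z) :=
    integral_congr_ae (by filter_upwards [rep_ae_eq u] with z hz; rw [hz])
  rw [e, integral_add i2 i3] at h
  simp only [sub_mul, neg_mul, integral_neg, neg_neg]
  rw [integral_sub i1 i2]
  linarith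

theorem rep_eq_rpow_mul {u w : Sobolev 1} (hv : ∀ z, 0 < oneAdd v z)
    (hw : w.1 0 =ᵐ[volume] fun z => oneAdd v z ^ m * u.1 0 z) :
    rep w = fun z => oneAdd v z ^ m * rep u z := by
  refine rep_eq_of_continuous _ ((continuous_comp_oneAdd (continuousOn_rpow m) hv).mul
    (isPrimitive_rep u).continuous) ?_
  filter_upwards [hw, rep_ae_eq u] with z h1 h2
  rw [h1, h2]

theorem one_ae_eq {u w : Sobolev 1} (hv : ∀ z, 0 < oneAdd v z)
    (hw : w.1 0 =ᵐ[volume] fun z => oneAdd v z ^ m * u.1 0 z) :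
    w.1 1 =ᵐ[volume] fun z => m * oneAdd v z ^ (m - 1) * v.1 1 z * rep u z
      + oneAdd v z ^ m * u.1 1 z := by
  have P := ((isPrimitive_oneAdd v).comp hv (fun _ h => hasDerivAt_rpow m h)
    (continuousOn_const.mul (continuousOn_rpow _))).mul (isPrimitive_rep u)
  have Q := isPrimitive_rep w
  rw [rep_eq_rpow_mul hv hw] at Q
  exact Q.deriv_unique P

/-- Inserting w = φ^m u, the two terms in φ_z² u cancel: this is (φ^{-m} φ_z)_t = u_z in variational
form. -/
theorem energyDerivDensity_ae_eq {u w : Sobolev 1} (n : ℝ) (hv : ∀ z, 0 < oneAdd v z)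
    (hw : w.1 0 =ᵐ[volume] fun z => oneAdd v z ^ m * u.1 0 z) :
    energyDerivDensity n m v w =ᵐ[volume] fun z =>
      multiplier n m (oneAdd v z) * (oneAdd v z ^ m * rep u z)
        + oneAdd v z ^ (-m) * v.1 1 z * u.1 1 z := by
  filter_upwards [one_ae_eq hv hw] with z hz
  have e1 : oneAdd v z ^ (-2 * m - 1) * oneAdd v z ^ m = oneAdd v z ^ (-m - 1) := by
    rw [← Real.rpow_add (hv z)]; congr 1; ring
  have e2 : oneAdd v z ^ (-2 * m) * oneAdd v z ^ (m - 1) = oneAdd v z ^ (-m - 1) := by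
    rw [← Real.rpow_add (hv z)]; congr 1; ring
  have e3 : oneAdd v z ^ (-2 * m) * oneAdd v z ^ m = oneAdd v z ^ (-m) := by
    rw [← Real.rpow_add (hv z)]; congr 1; ring
  rw [energyDerivDensity, hz, rep_eq_rpow_mul hv hw, ← e3]
  linear_combination m * v.1 1 z ^ 2 * rep u z * (e2 - e1)

/-- The density is almost everywhere minus the derivative of W(φ) J - P(φ). Since W(1) = 0 and J
tends to 1, this function has the same limit -P(1) at both ends. -/
theorem IsEllipticSolution.energyDeriv_eq_zero {u w : Sobolev 1} (H : IsEllipticSolution n m v u)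
    (hv : ∀ z, 0 < oneAdd v z) (hw : w.1 0 =ᵐ[volume] fun z => oneAdd v z ^ m * u.1 0 z) :
    energyDeriv n m v hv w = 0 := by
  obtain ⟨J, hJ, PJ⟩ := H.exists_flux hv
  have PW := (isPrimitive_oneAdd v).comp hv (fun _ h => hasDerivAt_multiplier n m h)
    (continuousOn_rpow _)
  have PP := (isPrimitive_oneAdd v).comp hv (fun _ h => hasDerivAt_fluxPrimitive m h)
    (continuousOn_rpow _)
  have Pf := (PW.mul PJ).sub PP
  have hD : (fun z => oneAdd v z ^ (-n - m) * v.1 1 z * J z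
      + multiplier n m (oneAdd v z) * -(oneAdd v z ^ m * rep u z)
      - oneAdd v z ^ (-m) * v.1 1 z) =ᵐ[volume] fun z => -energyDerivDensity n m v w z := by
    filter_upwards [hJ, energyDerivDensity_ae_eq n hv hw] with z h1 h2
    have e1 : oneAdd v z ^ (-n - m) * oneAdd v z ^ n = oneAdd v z ^ (-m) := by
      rw [← Real.rpow_add (hv z)]; congr 1; ring
    rw [h2, ← h1, ← e1]
    ring
  -- J - 1 and its derivative -φ^m u are square integrable, hence J tends to 1.
  have MJ : MemLp (fun z => J z - 1) 2 := by
    have h1 := (memLp_comp (v := v) (fun _ h => hasDerivAt_rpow n h)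
      (continuousOn_const.mul (continuousOn_rpow _)) hv).sub (memLp_rpow_mul n hv (memLp_one u))
    refine (memLp_congr_ae ?_).1 h1
    filter_upwards [hJ] with z hz
    rw [← hz, Pi.sub_apply, Real.one_rpow]
    ring
  have PJ1 := PJ.sub (.const 1)
  have MJ' : MemLp (fun z => -(oneAdd v z ^ m * rep u z) - 0) 2 := by
    simp only [sub_zero]
    exact (memLp_rpow_mul m hv (memLp_rep u)).neg
  have lim {l : Filter ℝ} (hl : l = atTop ∨ l = atBot) :
      Tendsto (fun z => multiplier n m (oneAdd v z) * J z - fluxPrimitive m (oneAdd v z)) l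
        (𝓝 (-fluxPrimitive m 1)) := by
    have t1 := tendsto_oneAdd v hl
    have tJ := (PJ1.tendsto_zero MJ MJ' hl).add_const 1
    have tW := (hasDerivAt_multiplier n m one_pos).continuousAt.tendsto.comp t1
    have tP := (hasDerivAt_fluxPrimitive m one_pos).continuousAt.tendsto.comp t1
    have := (tW.mul tJ).sub tP
    rw [multiplier_one, zero_mul, zero_sub] at this
    refine this.congr fun z => ?_
    simp
  have h0 := (Pf.congr_deriv hD).integral_eq_zero (integrable_energyDerivDensity n m hv w).neg
    (lim (Or.inl rfl)) (lim (Or.inr rfl))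
  rw [integral_neg, neg_eq_zero] at h0
  rw [energyDeriv_apply, h0]

end Sobolev

/-! ### Conservation of the energy for H¹ solutions -/

open Sobolev

theorem eq_oneAdd {φ : ℝ → ℝ} {v : Sobolev 1} (hφ : Continuous φ)
    (h : (fun z => φ z - 1) =ᵐ[volume] v.1 0) : φ = oneAdd v := by
  have := rep_eq_of_continuous v (hφ.sub continuous_const) h.symm
  ext z
  rw [oneAdd, this, Pi.sub_apply, add_sub_cancel]

theorem energy_oneAdd (n m : ℝ) (v : Sobolev 1) :
    energy n m (oneAdd v) = energyFunctional n m v := by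
  refine integral_congr_ae ?_
  filter_upwards [weakDeriv_ae_eq (isPrimitive_oneAdd v)] with z hz
  rw [hz]

namespace IsSolution

variable {n m T : ℝ} {φ : ℝ → ℝ → ℝ}

/-- By the chain rule the energy along the curve `U` has derivative 0 within [0, T), one-sided at 0;
the mean value inequality with constant 0 makes it constant. -/
theorem energy_eq (H : IsSolution n m 1 T φ) {t : ℝ} (ht : t ∈ Ico 0 T) :
    Integrable (fun z => energyDensity n m (φ t z) (weakDeriv (φ t) z)) ∧
      energy n m (φ t) = energy n m (φ 0) := by
  obtain ⟨U, hU, hφ, heq⟩ := H.equation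
  have eφ : ∀ s ∈ Ico 0 T, φ s = oneAdd (U s) := fun s hs =>
    eq_oneAdd (H.continuous s hs) (hφ s hs)
  have hpos : ∀ s ∈ Ico 0 T, ∀ z, 0 < oneAdd (U s) z := fun s hs z => eφ s hs ▸ H.pos s hs z
  have hder : ∀ s ∈ Ico 0 T,
      HasDerivWithinAt (fun r => energyFunctional n m (U r)) 0 (Ico 0 T) s := by
    intro s hs
    have hd := ((hU.differentiableOn (by simp)) s hs).hasDerivWithinAt
    obtain ⟨u, hu, hψ⟩ := heq s hs
    rw [eφ s hs] at hu hψ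
    have := (hasFDerivAt_energyFunctional n m (hpos s hs)).comp_hasDerivWithinAt s hd
    rwa [IsEllipticSolution.energyDeriv_eq_zero hψ (hpos s hs) hu] at this
  have h0 : (0 : ℝ) ∈ Ico 0 T := ⟨le_rfl, ht.1.trans_lt ht.2⟩
  constructor
  · rw [eφ t ht]
    refine (integrable_energyDensity n m (hpos t ht)).congr ?_
    filter_upwards [weakDeriv_ae_eq (isPrimitive_oneAdd (U t))] with z hz
    rw [hz]
  · rw [eφ t ht, eφ 0 h0, energy_oneAdd, energy_oneAdd]
    have := (convex_Ico 0 T).norm_image_sub_le_of_norm_hasDerivWithin_le (C := 0) hder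
      (fun _ _ => by simp) h0 ht
    rw [zero_mul, norm_le_zero_iff] at this
    exact sub_eq_zero.1 this

theorem uniqueDiffWithinAt_Ico {t : ℝ} (ht : t ∈ Ico 0 T) :
    UniqueDiffWithinAt ℝ (Ico 0 T) t := by
  refine (uniqueDiffWithinAt_convex (convex_Ico 0 T) ?_ (subset_closure ht))
  rw [interior_Ico]
  exact nonempty_Ioo.2 (ht.1.trans_lt ht.2)

theorem toSobolevOne (H : IsSolution n m 2 T φ) : IsSolution n m 1 T φ := by
  obtain ⟨U, hU, hφ, heq⟩ := H.equation
  refine ⟨H.continuous, H.pos, lower ∘ U, lower.contDiff.comp_contDiffOn hU, hφ,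
    fun t ht => ?_⟩
  obtain ⟨u, hu, hψ⟩ := heq t ht
  have hd := ((hU.differentiableOn (by simp)) t ht).hasDerivWithinAt
  refine ⟨u, ?_, hψ⟩
  rw [(lower.hasFDerivAt.comp_hasDerivWithinAt t hd).derivWithin (uniqueDiffWithinAt_Ico ht)]
  exact hu

end IsSolution

/-! ### The local conservation law for H² solutions -/

/-- The magma equation in strong form: the mass flux is differentiable, with derivative
`-φ_t`. -/
theorem Sobolev.IsEllipticSolution.hasDerivAt_massFlux {n m : ℝ} {v w : Sobolev 2} {u : Sobolev 1}
    (H : IsEllipticSolution n m (lower v) u) (hv : ∀ z, 0 < oneAdd (lower v) z)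
    (hw : w.1 0 =ᵐ[volume] fun z => oneAdd (lower v) z ^ m * u.1 0 z) (z : ℝ) :
    HasDerivAt (fun z => massFlux n m (oneAdd (lower v) z) (rep (derivative v) z)
      (rep (lower w) z) (rep (derivative w) z)) (-rep (lower w) z) z := by
  obtain ⟨J, hJ, PJ⟩ := H.exists_flux hv
  have hw' : (lower w).1 0 =ᵐ[volume] fun z => oneAdd (lower v) z ^ m * u.1 0 z := hw
  have cr (u : Sobolev 1) : Continuous (rep u) := (isPrimitive_rep u).continuous
  have cp (p : ℝ) := continuous_comp_oneAdd (continuousOn_rpow p) hv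
  have hc : Continuous fun z => massFlux n m (oneAdd (lower v) z) (rep (derivative v) z)
      (rep (lower w) z) (rep (derivative w) z) :=
    ((cp n).add (((continuous_const.mul (cp _)).mul (cr _)).mul (cr _))).sub ((cp _).mul (cr _))
  -- Expanding φ_tz by the product rule for φ_t = φ^m u turns `massFlux` into φ^n - φ^n u_z almost
  -- everywhere. Both `massFlux` and `J` are continuous, so they agree everywhere, and J has the
  -- continuous derivative -φ^m u.
  have e : (fun z => massFlux n m (oneAdd (lower v) z) (rep (derivative v) z)
      (rep (lower w) z) (rep (derivative w) z)) = J := by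
    refine (hc.ae_eq_iff_eq volume PJ.continuous).1 (EventuallyEq.trans ?_ hJ)
    filter_upwards [one_ae_eq hv hw', rep_ae_eq (derivative v), rep_ae_eq (derivative w)]
      with x h1 h2 h3
    rw [derivative_zero] at h2 h3
    rw [lower_one, lower_one, h2, h3] at h1
    have e1 : oneAdd (lower v) x ^ (n - m - 1) * oneAdd (lower v) x ^ m
        = oneAdd (lower v) x ^ (n - 1) := by
      rw [← Real.rpow_add (hv x)]; congr 1; ring
    have e2 : oneAdd (lower v) x ^ (n - m) * oneAdd (lower v) x ^ (m - 1)
        = oneAdd (lower v) x ^ (n - 1) := by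
      rw [← Real.rpow_add (hv x)]; congr 1; ring
    have e3 : oneAdd (lower v) x ^ (n - m) * oneAdd (lower v) x ^ m
        = oneAdd (lower v) x ^ n := by
      rw [← Real.rpow_add (hv x)]; congr 1; ring
    rw [massFlux, h1, rep_eq_rpow_mul hv hw']
    linear_combination (m * rep u x * rep (derivative v) x) * (e1 - e2) - u.1 1 x * e3
  rw [e]
  rw [rep_eq_rpow_mul hv hw']
  exact PJ.hasDerivAt ((cp m).mul (cr u)).neg z

theorem hasDerivWithinAt_energyDensity (n m : ℝ) {a b : ℝ → ℝ} {a' b' t : ℝ} {s : Set ℝ}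
    (ha : HasDerivWithinAt a a' s t) (hb : HasDerivWithinAt b b' s t) (hpos : 0 < a t) :
    HasDerivWithinAt (fun r => energyDensity n m (a r) (b r))
      (-m * a t ^ (-2 * m - 1) * b t ^ 2 * a' + multiplier n m (a t) * a'
        + a t ^ (-2 * m) * b t * b') s t := by
  have h1 := (hasDerivAt_rpow (-2 * m) hpos).comp_hasDerivWithinAt t ha
  have h2 := (hasDerivAt_potential n m hpos).comp_hasDerivWithinAt t ha
  refine (((h1.const_mul (1 / 2)).mul (hb.pow 2)).add h2).congr_deriv ?_
  simp
  ring

theorem hasDerivAt_energyFlux {n m : ℝ} {a b c d : ℝ → ℝ} {a' z : ℝ} {J' : ℝ}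
    (ha : HasDerivAt a a' z) (hpos : 0 < a z)
    (hJ : HasDerivAt (fun z => massFlux n m (a z) (b z) (c z) (d z)) J' z) :
    HasDerivAt (fun z => energyFlux n m (a z) (b z) (c z) (d z))
      (a z ^ (-n - m) * a' * massFlux n m (a z) (b z) (c z) (d z) + multiplier n m (a z) * J'
        - a z ^ (-m) * a') z :=
  (((hasDerivAt_multiplier n m hpos).comp z ha).mul hJ).sub
    ((hasDerivAt_fluxPrimitive m hpos).comp z ha)

namespace IsSolution

variable {n m T : ℝ} {φ : ℝ → ℝ → ℝ}

theorem local_conservation (H : IsSolution n m 2 T φ) {t : ℝ} (ht : t ∈ Ico 0 T) (z : ℝ) :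
    DifferentiableAt ℝ (φ t) z ∧
    DifferentiableWithinAt ℝ (fun s => φ s z) (Ico 0 T) t ∧
    DifferentiableAt ℝ (timeDeriv T φ t) z ∧
    DifferentiableWithinAt ℝ (fun s => e n m φ s z) (Ico 0 T) t ∧
    DifferentiableAt ℝ (f n m T φ t) z ∧
    derivWithin (fun s => e n m φ s z) (Ico 0 T) t + deriv (f n m T φ t) z = 0 := by
  obtain ⟨U, hU, hφ, heq⟩ := H.equation
  have eφ : ∀ s ∈ Ico 0 T, φ s = oneAdd (lower (U s)) := fun s hs =>
    eq_oneAdd (H.continuous s hs) (hφ s hs)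
  have hpos : ∀ x, 0 < oneAdd (lower (U t)) x := fun x => eφ t ht ▸ H.pos t ht x
  have hz : ∀ s ∈ Ico 0 T, ∀ x, HasDerivAt (φ s) (rep (derivative (U s)) x) x := fun s hs x => by
    rw [eφ s hs]
    exact (hasDerivAt_rep_lower (U s) x).const_add 1
  have hd := ((hU.differentiableOn (by simp)) t ht).hasDerivWithinAt
  obtain ⟨u, hu, hψ⟩ := heq t ht
  set U' := derivWithin U (Ico 0 T) t with hU'
  have htime : ∀ x, HasDerivWithinAt (fun s => φ s x) (rep (lower U') x) (Ico 0 T) t := fun x => by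
    have := (((eval x).comp lower).hasFDerivAt.comp_hasDerivWithinAt t hd).const_add 1
    exact this.congr (fun s hs => by rw [eφ s hs]; rfl) (by rw [eφ t ht]; rfl)
  -- This is φ_zt = φ_tz: differentiation in z followed by evaluation at a point is a bounded
  -- functional on H², so it commutes with the time derivative.
  have htz : HasDerivWithinAt (fun s => deriv (φ s) z) (rep (derivative U') z) (Ico 0 T) t := by
    have := ((eval z).comp derivative).hasFDerivAt.comp_hasDerivWithinAt t hd
    exact this.congr (fun s hs => (hz s hs z).deriv) (hz t ht z).deriv
  have hun := uniqueDiffWithinAt_Ico ht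
  have hT : timeDeriv T φ t = rep (lower U') := funext fun x => (htime x).derivWithin hun
  have hTz (x : ℝ) : HasDerivAt (timeDeriv T φ t) (rep (derivative U') x) x := by
    rw [hT]; exact hasDerivAt_rep_lower U' x
  have hD : deriv (φ t) = rep (derivative (U t)) := funext fun x => (hz t ht x).deriv
  have hDT : deriv (timeDeriv T φ t) = rep (derivative U') := funext fun x => (hTz x).deriv
  have he := hasDerivWithinAt_energyDensity n m (htime z) htz (H.pos t ht z)
  have hJ : HasDerivAt (fun x => massFlux n m (φ t x) (deriv (φ t) x) (timeDeriv T φ t x)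
      (deriv (timeDeriv T φ t) x)) (-rep (lower U') z) z := by
    rw [hD, hDT, hT, eφ t ht]
    rw [eφ t ht] at hu hψ
    exact IsEllipticSolution.hasDerivAt_massFlux hψ hpos hu z
  have hf := hasDerivAt_energyFlux (hz t ht z) (H.pos t ht z) hJ
  refine ⟨(hz t ht z).differentiableAt, (htime z).differentiableWithinAt,
    (hTz z).differentiableAt, he.differentiableWithinAt, hf.differentiableAt, ?_⟩
  have e1 : derivWithin (fun s => e n m φ s z) (Ico 0 T) t = _ := he.derivWithin hun
  have e2 : deriv (f n m T φ t) z = _ := hf.deriv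
  have p1 : φ t z ^ (-n - m) * φ t z ^ n = φ t z ^ (-m) := by
    rw [← Real.rpow_add (H.pos t ht z)]; congr 1; ring
  have p2 : φ t z ^ (-n - m) * φ t z ^ (n - m - 1) = φ t z ^ (-2 * m - 1) := by
    rw [← Real.rpow_add (H.pos t ht z)]; congr 1; ring
  have p3 : φ t z ^ (-n - m) * φ t z ^ (n - m) = φ t z ^ (-2 * m) := by
    rw [← Real.rpow_add (H.pos t ht z)]; congr 1; ring
  -- Once W' = φ^{-n-m} is multiplied into the flux, all terms cancel algebraically; the terms in W
  -- cancel because J_z = -φ_t.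
  rw [e1, e2, massFlux, hD, hDT, hT, ← p1, ← p2, ← p3]
  ring

theorem integrable_e (H : IsSolution n m 2 T φ) {t : ℝ} (ht : t ∈ Ico 0 T) :
    Integrable (e n m φ t) ∧ ∫ z, e n m φ t z = energy n m (φ t) := by
  have P : IsPrimitive (φ t) (deriv (φ t)) := by
    obtain ⟨U, -, hφ, -⟩ := H.equation
    rw [eq_oneAdd (v := lower (U t)) (H.continuous t ht) (hφ t ht)]
    have := isPrimitive_oneAdd (lower (U t))
    exact this.congr_deriv this.deriv_ae_eq.symm
  have hae : (fun z => energyDensity n m (φ t z) (weakDeriv (φ t) z)) =ᵐ[volume] e n m φ t := by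
    filter_upwards [weakDeriv_ae_eq P] with z hz
    rw [hz, e]
  exact ⟨(H.toSobolevOne.energy_eq ht).1.congr hae, (integral_congr_ae hae).symm⟩

end IsSolution

end Magma

end

theorem mainTheorem9 (n m T : ℝ) (φ : ℝ → ℝ → ℝ) :
    -- spatial regularity `H²`: local conservation law and conservation of the energy
    (Magma.IsSolution n m 2 T φ →
      (∀ t ∈ Set.Ico 0 T, ∀ z : ℝ,
        DifferentiableAt ℝ (φ t) z ∧
        DifferentiableWithinAt ℝ (fun s => φ s z) (Set.Ico 0 T) t ∧
        DifferentiableAt ℝ (Magma.timeDeriv T φ t) z ∧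
        DifferentiableWithinAt ℝ (fun s => Magma.e n m φ s z) (Set.Ico 0 T) t ∧
        DifferentiableAt ℝ (Magma.f n m T φ t) z ∧
        derivWithin (fun s => Magma.e n m φ s z) (Set.Ico 0 T) t
          + deriv (Magma.f n m T φ t) z = 0) ∧
      ∀ t ∈ Set.Ico 0 T,
        MeasureTheory.Integrable (Magma.e n m φ t) ∧
        ∫ z, Magma.e n m φ t z = Magma.energy n m (φ t) ∧
        Magma.energy n m (φ t) = Magma.energy n m (φ 0)) ∧
    -- spatial regularity `H¹`: conservation of the energy, for data of any size
    (Magma.IsSolution n m 1 T φ →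
      ∀ t ∈ Set.Ico 0 T,
        MeasureTheory.Integrable
          (fun z => Magma.energyDensity n m (φ t z) (Magma.weakDeriv (φ t) z)) ∧
        Magma.energy n m (φ t) = Magma.energy n m (φ 0)) := by
  exact ⟨fun H => ⟨fun t ht z => H.local_conservation ht z, fun t ht =>
    ⟨(H.integrable_e ht).1, (H.integrable_e ht).2, (H.toSobolevOne.energy_eq ht).2⟩⟩,
    fun H t ht => H.energy_eq ht⟩
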